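/- Let $\alpha\subseteq\lambda$ be partitions, written with positive parts only, $\lambda=(\lambda_1,\dots,\lambda_k)$ and $\alpha=(\alpha_1,\dots,\alpha_l)$, such that $\alpha_1<\lambda_1$ and $l<k$. For a partition $\nu$ of $n=|\lambda|-|\alpha|$ let $[\nu]$ be the irreducible character of the symmetric group $S_n$ afforded by the Specht module $S^\nu$, let $c(\lambda;\alpha,\nu)$ be the Littlewood–Richardson coefficient, i.e. the number of semistandard tableaux of shape $\lambda/\alpha$ and content $\nu$ whose reverse row word (rows read from right to left, from top to bottom) is a lattice word, and let $$[\lambda/\alpha]=\sum_{\nu\vdash n}c(\lambda;\alpha,\nu)\,[\nu]$$ be the skew character of $\lambda/\alpha$. A character is multiplicity-free if each irreducible character occurs in it with coefficient $0$ or $1$. The skew diagram $\lambda/\alpha$ is connected if its set of boxes is not the union of two disjoint non-empty sets $A,B$ such that no box of $A$ lies in the same row or column as a box of $B$. Suppose that $\lambda/\alpha$ is connected, that $\alpha$ has at least $2$ distinct part sizes and that $\lambda$ has at least $3$ distinct part sizes. Then $[\lambda/\alpha]$ is not multiplicity-free; that is, there is a partition $\nu$ of $n$ with $c(\lambda;\alpha,\nu)\ge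 2$. -/

import Mathlib

noncomputable section

namespace SkewChar

/-- The inner product of class functions `χ`, `ψ` on a finite group, `ψ` being evaluated at inverses
(for characters over `ℂ` this is complex conjugation). -/
def charInner {G : Type} [Group G] [Fintype G] (χ ψ : G → ℂ) : ℂ :=
  (Fintype.card G : ℂ)⁻¹ * ∑ g : G, χ g * ψ g⁻¹

/-- A character of a finite group is multiplicity-free if each irreducible complex character occurs
in it with coefficient `0` or `1`. -/
def IsMultiplicityFree {G : Type} [Group G] [Fintype G] (χ : G → ℂ) : Prop :=
  ∀ (V : Type) [AddCommGroup V] [Module ℂ V] [FiniteDimensional ℂ V] (ρ : Representation ℂ G V),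
    ρ.IsIrreducible → charInner χ ρ.character = 0 ∨ charInner χ ρ.character = 1

/-! ### Specht modules

A tableau of shape `ν` with entries `0, …, n - 1` is a bijection `t : Fin n ≃ ν.cells` sending an
entry to its box. The permutation `σ` acts on tableaux by applying `σ` to all entries. -/

/-- The tabloid `{t}` of a tableau `t`, i.e. `t` up to permutations of entries inside the rows. It is
recorded as the function that sends each entry to the index of its row. -/
def tabloid {n : ℕ} {ν : YoungDiagram} (t : Fin n ≃ ν.cells) : Fin n → ℕ :=
  fun k => (t k).1.1

/-- The column group of a tableau `t`: the permutations of the entries that keep every entry in its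
column. -/
def IsColumnPerm {n : ℕ} {ν : YoungDiagram} (t : Fin n ≃ ν.cells)
    (π : Equiv.Perm (Fin n)) : Prop :=
  ∀ k, (t (π k)).1.2 = (t k).1.2

/-- The permutation representation of `S_n` on the vector space with basis the row assignments
`Fin n → ℕ`; the permutation module on the tabloids of a fixed shape is a subrepresentation. -/
def tabloidRep (n : ℕ) : Representation ℂ (Equiv.Perm (Fin n)) ((Fin n → ℕ) →₀ ℂ) where
  toFun σ := Finsupp.lmapDomain ℂ ℂ (fun f : Fin n → ℕ => f ∘ σ.symm)
  map_one' := by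
    ext f g
    simp [Finsupp.mapDomain_single, Equiv.Perm.one_def]
  map_mul' σ τ := by
    ext f g
    simp [Finsupp.mapDomain_single, Equiv.Perm.mul_def, Function.comp_assoc]

open scoped Classical in
/-- The polytabloid `e_t = ∑_{π ∈ C_t} sgn(π) π{t}`. -/
def polytabloid {n : ℕ} {ν : YoungDiagram} (t : Fin n ≃ ν.cells) : (Fin n → ℕ) →₀ ℂ :=
  ∑ π : Equiv.Perm (Fin n) with IsColumnPerm t π,
    ((Equiv.Perm.sign π : ℤ) : ℂ) • tabloidRep n π (Finsupp.single (tabloid t) 1)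

/-- The Specht module `S^ν`: the span of all polytabloids of shape `ν`. -/
def spechtModule (n : ℕ) (ν : YoungDiagram) : Submodule ℂ ((Fin n → ℕ) →₀ ℂ) :=
  Submodule.span ℂ (Set.range fun t : Fin n ≃ ν.cells => polytabloid t)

theorem tabloidRep_polytabloid {n : ℕ} {ν : YoungDiagram} (σ : Equiv.Perm (Fin n))
    (t : Fin n ≃ ν.cells) :
    tabloidRep n σ (polytabloid t) = polytabloid (σ.symm.trans t) := by
  classical
  unfold polytabloid
  rw [map_sum]
  refine Finset.sum_bij (fun π _ => σ * π * σ⁻¹) ?_ ?_ ?_ ?_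
  · intro π hπ
    refine Finset.mem_filter.2 ⟨Finset.mem_univ _, fun k => ?_⟩
    have hπ := (Finset.mem_filter.1 hπ).2
    simpa [Equiv.Perm.inv_def] using hπ (σ.symm k)
  · intro a _ b _ h
    simpa using h
  · intro π hπ
    refine ⟨σ⁻¹ * π * σ, Finset.mem_filter.2 ⟨Finset.mem_univ _, fun k => ?_⟩, by group⟩
    have hπ := (Finset.mem_filter.1 hπ).2
    simpa [Equiv.Perm.inv_def] using hπ (σ k)
  · intro π _
    have h1 : Finsupp.single (tabloid (σ.symm.trans t)) (1 : ℂ)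
        = tabloidRep n σ (Finsupp.single (tabloid t) 1) := by
      simp [tabloidRep, Finsupp.mapDomain_single]
      rfl
    rw [h1, map_smul, ← Module.End.mul_apply, ← map_mul, ← Module.End.mul_apply, ← map_mul]
    have h2 : (Equiv.Perm.sign (σ * π * σ⁻¹)) = Equiv.Perm.sign π := by
      rw [map_mul, map_mul, mul_right_comm, map_inv, mul_inv_cancel, one_mul]
    rw [h2, show σ * π * σ⁻¹ * σ = σ * π by group]

theorem spechtModule_le_comap (n : ℕ) (ν : YoungDiagram) (σ : Equiv.Perm (Fin n)) :
    spechtModule n ν ≤ (spechtModule n ν).comap (tabloidRep n σ) := by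
  unfold spechtModule
  rw [Submodule.span_le]
  rintro _ ⟨t, rfl⟩
  simp only [SetLike.mem_coe, Submodule.mem_comap, tabloidRep_polytabloid]
  exact Submodule.subset_span ⟨_, rfl⟩

/-- The action of `S_n` on the Specht module `S^ν`, for `ν` a partition of `n`. -/
def spechtRep (n : ℕ) (ν : YoungDiagram) :
    Representation ℂ (Equiv.Perm (Fin n)) (spechtModule n ν) :=
  (tabloidRep n).subrepresentation (spechtModule n ν) (spechtModule_le_comap n ν)

/-- The irreducible character `[ν]` of `S_n`, for `ν` a partition of `n`. -/
def spechtChar (n : ℕ) (ν : YoungDiagram) : Equiv.Perm (Fin n) → ℂ :=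
  Representation.character (k := ℂ) (V := spechtModule n ν) (spechtRep n ν)

/-! ### Skew diagrams and Littlewood–Richardson coefficients -/

/-- The set of boxes of the skew diagram `lam / α`, in matrix coordinates (starting from `0`). -/
def skewCells (lam α : YoungDiagram) : Finset (ℕ × ℕ) :=
  lam.cells \ α.cells

/-- `D` decomposes into two disconnected diagrams if it is the disjoint union of non-empty `A`, `B`
such that no box of `A` is in the same row or column as a box of `B`. -/
def Decomposes (D : Finset (ℕ × ℕ)) : Prop :=
  ∃ A B : Finset (ℕ × ℕ), A.Nonempty ∧ B.Nonempty ∧ A ∪ B = D ∧ Disjoint A B ∧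
    ∀ a ∈ A, ∀ b ∈ B, a.1 ≠ b.1 ∧ a.2 ≠ b.2

/-- `D` is connected: it is non-empty and does not decompose. -/
def IsConnectedDiagram (D : Finset (ℕ × ℕ)) : Prop :=
  D.Nonempty ∧ ¬ Decomposes D

/-- `c` is read before `b`, or equals `b`, when the boxes are read from right to left in each row and
the rows from top to bottom. -/
def ReadUpTo (c b : ℕ × ℕ) : Prop :=
  c.1 < b.1 ∨ (c.1 = b.1 ∧ b.2 ≤ c.2)

open scoped Classical in
/-- `T` is a Littlewood–Richardson tableau of shape `lam / α` and content `ν`. The filling is a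
function on all of `ℕ × ℕ` that is positive on the boxes of `lam / α` and, so that fillings are counted
only once, `0` elsewhere. -/
structure IsLRTableau (lam α ν : YoungDiagram) (T : ℕ × ℕ → ℕ) : Prop where
  pos : ∀ b ∈ skewCells lam α, 0 < T b
  zero : ∀ b ∉ skewCells lam α, T b = 0
  row_weak : ∀ i j, (i, j) ∈ skewCells lam α → (i, j + 1) ∈ skewCells lam α →
    T (i, j) ≤ T (i, j + 1)
  col_strict : ∀ i j, (i, j) ∈ skewCells lam α → (i + 1, j) ∈ skewCells lam α →
    T (i, j) < T (i + 1, j)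
  /-- The entry `m + 1` occurs as often as row `m` of `ν`, rows counted from `0`, has boxes. -/
  content : ∀ m, ((skewCells lam α).filter fun c => T c = m + 1).card = ν.rowLen m
  /-- The reverse row word is a lattice word: in each initial segment, which ends at some box `b`,
  each entry `m ≥ 1` occurs at least as often as `m + 1`. -/
  lattice : ∀ b ∈ skewCells lam α, ∀ m, 1 ≤ m →
    ((skewCells lam α).filter fun c => ReadUpTo c b ∧ T c = m + 1).card ≤
      ((skewCells lam α).filter fun c => ReadUpTo c b ∧ T c = m).card

/-- There are only finitely many LR-tableaux of given shape and content. -/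
theorem finite_isLRTableau (lam α ν : YoungDiagram) : {T | IsLRTableau lam α ν T}.Finite := by
  classical
  refine Set.Finite.of_finite_image (f := fun T : ℕ × ℕ → ℕ => fun b : skewCells lam α => T b)
    ((Set.finite_Iic (fun _ : skewCells lam α => ν.colLen 0)).subset ?_) ?_
  · rintro _ ⟨T, hT, rfl⟩ b
    obtain ⟨m, hm⟩ : ∃ m, T b = m + 1 := ⟨T b - 1, by have := hT.pos b b.2; omega⟩
    have h0 : 0 < ν.rowLen m := by
      rw [← hT.content m, Finset.card_pos]
      exact ⟨b, by simp [hm]⟩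
    rw [← YoungDiagram.mem_iff_lt_rowLen, YoungDiagram.mem_iff_lt_colLen] at h0
    change T b ≤ ν.colLen 0
    omega
  · intro S hS T hT h
    funext b
    by_cases hb : b ∈ skewCells lam α
    · exact congrFun h ⟨b, hb⟩
    · rw [hS.zero b hb, hT.zero b hb]

/-- The Littlewood–Richardson coefficient `c(lam; α, ν)`: the number of LR-tableaux. -/
def lrCoeff (lam α ν : YoungDiagram) : ℕ :=
  {T | IsLRTableau lam α ν T}.ncard

theorem finite_card_eq (n : ℕ) : {ν : YoungDiagram | ν.card = n}.Finite := by
  classical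
  refine Set.Finite.of_finite_image (f := YoungDiagram.cells)
    ((Finset.range n ×ˢ Finset.range n).powerset.finite_toSet.subset ?_)
    (fun a _ b _ h => YoungDiagram.ext h)
  rintro _ ⟨ν, rfl, rfl⟩
  simp only [Finset.mem_coe, Finset.mem_powerset]
  rintro ⟨i, j⟩ hij
  rw [YoungDiagram.mem_cells] at hij
  simp only [Finset.mem_product, Finset.mem_range]
  constructor
  · refine (YoungDiagram.mem_iff_lt_colLen.1 hij).trans_le ?_
    rw [YoungDiagram.colLen_eq_card]
    exact Finset.card_le_card (Finset.filter_subset _ _)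
  · refine (YoungDiagram.mem_iff_lt_rowLen.1 hij).trans_le ?_
    rw [YoungDiagram.rowLen_eq_card]
    exact Finset.card_le_card (Finset.filter_subset _ _)

/-- The partitions of `n`, as Young diagrams. -/
def partitionsOf (n : ℕ) : Finset YoungDiagram :=
  (finite_card_eq n).toFinset

/-- The skew character `[lam / α] = ∑_ν c(lam; α, ν) [ν]` of `S_n`, where `n` is the number of boxes of
`lam / α` and `ν` runs over the partitions of `n`. -/
def skewCharacter (lam α : YoungDiagram) :
    Equiv.Perm (Fin (skewCells lam α).card) → ℂ :=
  fun σ => ∑ ν ∈ partitionsOf (skewCells lam α).card,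
    (lrCoeff lam α ν : ℂ) * spechtChar (skewCells lam α).card ν σ

/-- The number of distinct (positive) part sizes of a partition. -/
def numPartSizes (ν : YoungDiagram) : ℕ :=
  ν.rowLens.toFinset.card

end SkewChar

end

open Finset

/-! A Littlewood–Richardson tableau is the same thing as a chain of partitions growing from $\alpha$
to $\lambda$, and the conditions on such a chain are homogeneous linear inequalities in its row
lengths. Patterns can therefore be added, and adding shapes row by row means taking the union of
their multisets of columns. So it suffices to find two patterns with equal content on a few columns
of $\lambda/\alpha$: adding one fixed pattern on the remaining columns keeps them distinct with
equal content (`HasTwoPatterns.add`, `hasTwoPatterns_of_subset`).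

Connectedness and the two size conditions make every column non-empty (`colLen_lt_colLen`). The
first column has the lowest top and bottom, the last one the highest. Two part sizes of $\alpha$
give a column $p$ whose top is strictly between these extremes; three part sizes of $\lambda$ give a
column $q$ whose bottom is. Either one column is intermediate in both respects, and three columns
suffice (`hasTwoPatterns_three_columns`), or the columns first, $p$, $q$, last form one of two
configurations (`hasTwoPatterns_four_columns_bottom`, `hasTwoPatterns_four_columns_top`).

In these cases the columns are filled with runs of consecutive entries. Regrouped across columns,
the runs form chains $1,2,\dots,n$ going strictly downwards. Each chain satisfies the lattice
condition by itself, and the chain lengths determine the content. The second filling shifts single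
boxes between columns while keeping all chain lengths.

For characters, it is enough that $S^\nu\ne 0$: an irreducible constituent of $S^\nu$ occurs at
least $c(\lambda;\alpha,\nu)\ge 2$ times, since all other contributions are non-negative. -/

/-- `g i m` is the length of row `i` of the partition formed by the boxes of the inner shape and the
boxes with entry at most `m` of a Littlewood–Richardson tableau. -/
structure IsLRPattern (g : ℕ → ℕ → ℕ) : Prop where
  mono : ∀ i m, g i m ≤ g i (m + 1)
  strict : ∀ i m, g (i + 1) (m + 1) ≤ g i m
  lattice : ∀ i m, ∑ r ∈ range (i + 1), g r (m + 2) + ∑ r ∈ range i, g r m ≤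
    ∑ r ∈ range (i + 1), g r (m + 1) + ∑ r ∈ range i, g r (m + 1)

/-- A Littlewood–Richardson pattern with row lengths `a` of the inner shape and `l` of the outer
shape. -/
structure IsPatternOf (a l : ℕ → ℕ) (g : ℕ → ℕ → ℕ) : Prop extends IsLRPattern g where
  zero : ∀ i, g i 0 = a i
  top : ∃ M, ∀ i m, M ≤ m → g i m = l i

/-- There are two distinct patterns with the same shape and the same content. -/
def HasTwoPatterns (a l : ℕ → ℕ) : Prop :=
  ∃ g g', IsPatternOf a l g ∧ IsPatternOf a l g' ∧
    (∃ K₀, ∀ K, K₀ ≤ K → ∀ m, ∑ r ∈ range K, g r m = ∑ r ∈ range K, g' r m) ∧ g ≠ g'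

/-! ### Addition of patterns -/

theorem IsLRPattern.add {g h : ℕ → ℕ → ℕ} (hg : IsLRPattern g) (hh : IsLRPattern h) :
    IsLRPattern (g + h) where
  mono i m := Nat.add_le_add (hg.mono i m) (hh.mono i m)
  strict i m := Nat.add_le_add (hg.strict i m) (hh.strict i m)
  lattice i m := by
    simp only [Pi.add_apply, sum_add_distrib]
    have := hg.lattice i m
    have := hh.lattice i m
    omega

theorem IsPatternOf.add {a l a' l' : ℕ → ℕ} {g h : ℕ → ℕ → ℕ} (hg : IsPatternOf a l g)
    (hh : IsPatternOf a' l' h) : IsPatternOf (a + a') (l + l') (g + h) where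
  toIsLRPattern := hg.toIsLRPattern.add hh.toIsLRPattern
  zero i := by simp [hg.zero, hh.zero]
  top := by
    obtain ⟨M, hM⟩ := hg.top
    obtain ⟨N, hN⟩ := hh.top
    refine ⟨max M N, fun i m hm => ?_⟩
    simp [hM i m (by omega), hN i m (by omega)]

theorem isPatternOf_zero : IsPatternOf 0 0 0 :=
  ⟨⟨by simp, by simp, by simp⟩, by simp, ⟨0, by simp⟩⟩

theorem IsPatternOf.sum {ι : Type*} (s : Finset ι) {a l : ι → ℕ → ℕ} {g : ι → ℕ → ℕ → ℕ}
    (h : ∀ j ∈ s, IsPatternOf (a j) (l j) (g j)) :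
    IsPatternOf (∑ j ∈ s, a j) (∑ j ∈ s, l j) (∑ j ∈ s, g j) := by
  classical
  induction s using Finset.induction_on with
  | empty => exact isPatternOf_zero
  | insert j s hj ih =>
    rw [sum_insert hj, sum_insert hj, sum_insert hj]
    exact (h j (mem_insert_self j s)).add (ih fun k hk => h k (mem_insert_of_mem hk))

theorem HasTwoPatterns.add {a l a' l' : ℕ → ℕ} {h : ℕ → ℕ → ℕ} (H : HasTwoPatterns a l)
    (hh : IsPatternOf a' l' h) : HasTwoPatterns (a + a') (l + l') := by
  obtain ⟨g, g', hg, hg', ⟨K₀, hK⟩, hne⟩ := H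
  refine ⟨g + h, g' + h, hg.add hh, hg'.add hh, ⟨K₀, fun K hK₀ m => ?_⟩, fun h => hne ?_⟩
  · simp only [Pi.add_apply, sum_add_distrib, hK K hK₀ m]
  · exact add_right_cancel h

/-! ### From patterns to Littlewood–Richardson tableaux -/

/-- The tableau encoded by a pattern. -/
noncomputable def tableauOf (g : ℕ → ℕ → ℕ) (b : ℕ × ℕ) : ℕ :=
  sInf {m | b.2 < g b.1 m}

theorem IsLRPattern.monotone {g : ℕ → ℕ → ℕ} (hg : IsLRPattern g) (i : ℕ) : Monotone (g i) :=
  monotone_nat_of_le_succ (hg.mono i)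

theorem IsLRPattern.tableauOf_eq_succ {g : ℕ → ℕ → ℕ} (hg : IsLRPattern g) (b : ℕ × ℕ) (m : ℕ) :
    tableauOf g b = m + 1 ↔ g b.1 m ≤ b.2 ∧ b.2 < g b.1 (m + 1) := by
  have hup : IsUpperSet {m | b.2 < g b.1 m} := fun x y hxy hx => lt_of_lt_of_le hx
    (hg.monotone b.1 hxy)
  rw [tableauOf, Nat.sInf_upward_closed_eq_succ_iff (fun x y hxy hx => hup hxy hx)]
  simp only [Set.mem_ofPred_eq, not_lt]
  tauto

theorem IsLRPattern.lt_of_tableauOf_pos {g : ℕ → ℕ → ℕ} {b : ℕ × ℕ} (h : 0 < tableauOf g b) :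
    b.2 < g b.1 (tableauOf g b) := by
  have : {m | b.2 < g b.1 m}.Nonempty := Nat.nonempty_of_pos_sInf h
  exact Nat.sInf_mem this

theorem tableauOf_le {g : ℕ → ℕ → ℕ} {b : ℕ × ℕ} {m : ℕ} (h : b.2 < g b.1 m) :
    tableauOf g b ≤ m :=
  Nat.sInf_le h

theorem mem_skewCells_iff {lam α : YoungDiagram} {b : ℕ × ℕ} :
    b ∈ SkewChar.skewCells lam α ↔ α.rowLen b.1 ≤ b.2 ∧ b.2 < lam.rowLen b.1 := by
  obtain ⟨i, j⟩ := b
  simp [SkewChar.skewCells, YoungDiagram.mem_iff_lt_rowLen, and_comm]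

section

variable {lam α : YoungDiagram} {g : ℕ → ℕ → ℕ}

theorem IsPatternOf.le_top {a l : ℕ → ℕ} (hg : IsPatternOf a l g) (i m : ℕ) : g i m ≤ l i := by
  obtain ⟨M, hM⟩ := hg.top
  rw [← hM i (max m M) (le_max_right _ _)]
  exact hg.monotone i (le_max_left _ _)

/-- The value `0` arises in two ways: on the inner shape because `m = 0` already qualifies, and
outside the outer shape because the set is empty and `sInf ∅ = 0`. -/
theorem IsPatternOf.tableauOf_pos_iff (hg : IsPatternOf α.rowLen lam.rowLen g) (b : ℕ × ℕ) :
    0 < tableauOf g b ↔ b ∈ SkewChar.skewCells lam α := by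
  rw [mem_skewCells_iff]
  constructor
  · intro h
    obtain ⟨m, hm⟩ : ∃ m, tableauOf g b = m + 1 := ⟨tableauOf g b - 1, by omega⟩
    obtain ⟨h1, h2⟩ := (hg.tableauOf_eq_succ b m).1 hm
    have := hg.le_top b.1 (m + 1)
    have := hg.monotone b.1 (Nat.zero_le m)
    rw [hg.zero] at this
    omega
  · rintro ⟨h1, h2⟩
    obtain ⟨M, hM⟩ := hg.top
    have hne : {m | b.2 < g b.1 m}.Nonempty := ⟨M, by simpa [hM b.1 M le_rfl] using h2⟩
    rw [Nat.pos_iff_ne_zero]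
    intro h0
    have := Nat.sInf_mem hne
    rw [show sInf {m | b.2 < g b.1 m} = 0 from h0] at this
    simp only [Set.mem_ofPred_eq, hg.zero] at this
    omega

theorem IsPatternOf.card_filter_row (hg : IsPatternOf α.rowLen lam.rowLen g) (i m : ℕ)
    (s : Finset (ℕ × ℕ))
    (hs : ∀ c, c ∈ s ↔ c.1 = i ∧ tableauOf g c = m + 1) :
    s.card + g i m = g i (m + 1) := by
  have : s = (Ico (g i m) (g i (m + 1))).image (fun j => (i, j)) := by
    ext c
    obtain ⟨i', j⟩ := c
    simp only [hs, hg.tableauOf_eq_succ, mem_image, mem_Ico, Prod.mk.injEq]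
    constructor
    · rintro ⟨rfl, h⟩
      exact ⟨j, h, rfl, rfl⟩
    · rintro ⟨_, h, rfl, rfl⟩
      exact ⟨rfl, h⟩
  rw [this, card_image_of_injective _ (fun a b h => by simpa using h), Nat.card_Ico,
    Nat.sub_add_cancel (hg.mono i m)]

theorem IsPatternOf.card_filter_rows (hg : IsPatternOf α.rowLen lam.rowLen g) (K m : ℕ)
    (s : Finset (ℕ × ℕ))
    (hs : ∀ c, c ∈ s ↔ c.1 < K ∧ tableauOf g c = m + 1) :
    s.card + ∑ r ∈ range K, g r m = ∑ r ∈ range K, g r (m + 1) := by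
  classical
  have h := card_eq_sum_card_fiberwise (f := Prod.fst) (s := s) (t := range K)
    (fun c hc => by simpa using ((hs c).1 hc).1)
  rw [h, ← sum_add_distrib]
  refine sum_congr rfl fun r hr => hg.card_filter_row r m _ fun c => ?_
  rw [mem_filter, hs]
  have := mem_range.1 hr
  constructor
  · tauto
  · rintro ⟨rfl, h⟩
    exact ⟨⟨this, h⟩, rfl⟩

open scoped Classical in
theorem IsPatternOf.isLRTableau (hg : IsPatternOf α.rowLen lam.rowLen g) {ν : YoungDiagram} {K : ℕ}
    (hK : lam.colLen 0 ≤ K)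
    (hν : ∀ m, ν.rowLen m + ∑ r ∈ range K, g r m = ∑ r ∈ range K, g r (m + 1)) :
    SkewChar.IsLRTableau lam α ν (tableauOf g) where
  pos b hb := (hg.tableauOf_pos_iff b).2 hb
  zero b hb := by
    have := (hg.tableauOf_pos_iff b).not.2 hb
    omega
  row_weak i j _ h2 := by
    have h := IsLRPattern.lt_of_tableauOf_pos ((hg.tableauOf_pos_iff _).2 h2)
    exact tableauOf_le (lt_of_le_of_lt (Nat.le_succ j) h)
  col_strict i j _ h2 := by
    have h0 := (hg.tableauOf_pos_iff _).2 h2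
    have h := IsLRPattern.lt_of_tableauOf_pos h0
    obtain ⟨m, hm⟩ : ∃ m, tableauOf g (i + 1, j) = m + 1 := ⟨tableauOf g (i + 1, j) - 1, by omega⟩
    rw [hm] at h ⊢
    exact Nat.lt_succ_of_le (tableauOf_le (lt_of_lt_of_le h (hg.strict i m)))
  content m := by
    have := hg.card_filter_rows K m ((SkewChar.skewCells lam α).filter fun c => tableauOf g c = m + 1)
      (fun c => by
        rw [mem_filter]
        constructor
        · rintro ⟨h1, h2⟩
          refine ⟨lt_of_lt_of_le ?_ hK, h2⟩
          have h1 := (mem_skewCells_iff.1 h1).2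
          rw [← YoungDiagram.mem_iff_lt_colLen, YoungDiagram.mem_iff_lt_rowLen]
          omega
        · rintro ⟨_, h2⟩
          exact ⟨(hg.tableauOf_pos_iff c).1 (by omega), h2⟩)
    have := hν m
    omega
  lattice b hb m hm := by
    obtain ⟨m, rfl⟩ : ∃ k, m = k + 1 := ⟨m - 1, by omega⟩
    have hmem : ∀ c k, tableauOf g c = k + 1 → c ∈ SkewChar.skewCells lam α := fun c k h =>
      (hg.tableauOf_pos_iff c).1 (by omega)
    have h1 := hg.card_filter_rows (b.1 + 1) (m + 1)
      ((SkewChar.skewCells lam α).filter fun c => c.1 < b.1 + 1 ∧ tableauOf g c = m + 1 + 1)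
      (fun c => by rw [mem_filter]; exact ⟨And.right, fun h => ⟨hmem c _ h.2, h⟩⟩)
    have h2 := hg.card_filter_rows b.1 m
      ((SkewChar.skewCells lam α).filter fun c => c.1 < b.1 ∧ tableauOf g c = m + 1)
      (fun c => by rw [mem_filter]; exact ⟨And.right, fun h => ⟨hmem c _ h.2, h⟩⟩)
    have h3 := hg.lattice b.1 m
    -- The pattern inequality counts the larger entry including all of row `b.1` and the smaller one
    -- excluding that row, so it covers every initial segment ending in this row.
    have h4 : ((SkewChar.skewCells lam α).filter
        fun c => c.1 < b.1 + 1 ∧ tableauOf g c = m + 1 + 1).card ≤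
        ((SkewChar.skewCells lam α).filter fun c => c.1 < b.1 ∧ tableauOf g c = m + 1).card := by
      simp only [add_assoc, one_add_one_eq_two] at h1 h2 h3 ⊢
      omega
    refine le_trans (card_le_card (monotone_filter_right _ fun c _ hc => ?_)) (h4.trans
      (card_le_card (monotone_filter_right _ fun c _ hc => ?_)))
    · refine ⟨?_, hc.2⟩
      rcases hc.1 with h | h <;> omega
    · exact ⟨Or.inl hc.1, hc.2⟩

end

/-! ### Contents as partitions, and a lower bound for the coefficient -/

theorem exists_youngDiagram_rowLen (f : ℕ → ℕ) (hf : Antitone f) {M : ℕ} (hM : f M = 0) :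
    ∃ ν : YoungDiagram, ∀ m, ν.rowLen m = f m := by
  classical
  let ν : YoungDiagram :=
    { cells := (range M ×ˢ range (f 0)).filter fun c => c.2 < f c.1
      isLowerSet := by
        rintro ⟨i, j⟩ ⟨i', j'⟩ ⟨h1, h2⟩ h
        simp only [coe_filter, mem_product, mem_range, Set.mem_ofPred_eq] at h h1 h2 ⊢
        have := hf h1
        omega }
  refine ⟨ν, fun m => ?_⟩
  have key : ∀ j, j < ν.rowLen m ↔ j < f m := fun j => by
    rw [← YoungDiagram.mem_iff_lt_rowLen, ← YoungDiagram.mem_cells]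
    simp only [ν, mem_filter, mem_product, mem_range]
    have h0 := hf (Nat.zero_le m)
    constructor
    · tauto
    · intro h
      refine ⟨⟨?_, by omega⟩, h⟩
      by_contra hc
      have := hf (not_lt.1 hc)
      omega
  have h1 := key (ν.rowLen m)
  have h2 := key (f m)
  omega

theorem SkewChar.IsLRTableau.card_eq {lam α ν : YoungDiagram} {T : ℕ × ℕ → ℕ}
    (h : SkewChar.IsLRTableau lam α ν T) : ν.card = (SkewChar.skewCells lam α).card := by
  classical
  obtain ⟨N, hN⟩ : ∃ N, ∀ c ∈ SkewChar.skewCells lam α, T c < N :=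
    ⟨(SkewChar.skewCells lam α).sup T + 1, fun c hc => Nat.lt_succ_of_le (le_sup hc)⟩
  have h1 := card_eq_sum_card_fiberwise (f := fun c => T c - 1) (s := SkewChar.skewCells lam α)
    (t := range (N + ν.colLen 0)) (fun c hc => by
      have := hN c hc
      simp only [coe_range, Set.mem_Iio]
      omega)
  have h2 := card_eq_sum_card_fiberwise (f := Prod.fst) (s := ν.cells)
    (t := range (N + ν.colLen 0)) (fun c hc => by
      simp only [coe_range, Set.mem_Iio]
      have : (c.1, 0) ∈ ν := ν.up_left_mem le_rfl (Nat.zero_le c.2) (by simpa using hc)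
      have := YoungDiagram.mem_iff_lt_colLen.1 this
      omega)
  rw [YoungDiagram.card, h2, h1]
  refine sum_congr rfl fun m _ => ?_
  have h3 := h.content m
  have h4 : ν.rowLen m = _ := ν.rowLen_eq_card
  rw [YoungDiagram.row] at h4
  refine Eq.trans (h4.symm.trans h3.symm) (congrArg card (filter_congr fun c hc => ?_))
  have := h.pos c hc
  omega

theorem HasTwoPatterns.exists_two_le_lrCoeff {lam α : YoungDiagram}
    (H : HasTwoPatterns α.rowLen lam.rowLen) :
    ∃ ν : YoungDiagram, ν.card = (SkewChar.skewCells lam α).card ∧ 2 ≤ SkewChar.lrCoeff lam α ν := by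
  obtain ⟨g, g', hg, hg', ⟨K₀, hK⟩, hne⟩ := H
  set K := K₀ + lam.colLen 0 with hKdef
  have hKlam : ∀ i, K ≤ i → lam.rowLen i = 0 := fun i hi => by
    by_contra hc
    have h1 : (i, 0) ∈ lam := YoungDiagram.mem_iff_lt_rowLen.2 (by omega)
    have := YoungDiagram.mem_iff_lt_colLen.1 h1
    omega
  obtain ⟨M, hM⟩ := hg.top
  have hmono : ∀ m, ∑ r ∈ range K, g r m ≤ ∑ r ∈ range K, g r (m + 1) := fun m =>
    sum_le_sum fun r _ => hg.mono r m
  -- The number of entries `m + 1` weakly decreases in `m`: this is the lattice condition at row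
  -- `K`, which is below the outer shape and contributes nothing.
  obtain ⟨ν, hν⟩ := exists_youngDiagram_rowLen
    (fun m => ∑ r ∈ range K, g r (m + 1) - ∑ r ∈ range K, g r m)
    (antitone_nat_of_succ_le fun m => by
      have h1 := hg.lattice K m
      have h2 : g K (m + 2) = 0 := by
        have := hg.le_top K (m + 2)
        rw [hKlam K le_rfl] at this
        omega
      have := hmono m
      rw [sum_range_succ, sum_range_succ, h2] at h1
      have h3 : g K (m + 1) = 0 := by
        have := hg.le_top K (m + 1)
        rw [hKlam K le_rfl] at this
        omega
      rw [h3] at h1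
      simp only [add_assoc, one_add_one_eq_two] at h1 ⊢
      omega)
    (M := M) (by
      simp only [fun r => hM r (M + 1) (by omega), fun r => hM r M le_rfl, tsub_self])
  have hν : ∀ m, ν.rowLen m + ∑ r ∈ range K, g r m = ∑ r ∈ range K, g r (m + 1) := fun m => by
    rw [hν]
    exact Nat.sub_add_cancel (hmono m)
  have hT := hg.isLRTableau (by omega) hν
  have hT' := hg'.isLRTableau (K := K) (ν := ν) (by omega) fun m => by
    rw [← hK K (by omega), ← hK K (by omega)]
    exact hν m
  refine ⟨ν, hT.card_eq, ?_⟩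
  have hdiff : tableauOf g ≠ tableauOf g' := fun heq => hne <| by
    funext i m
    -- A pattern can be read off from its tableau: if `g' i m < g i m`, the box `(i, g' i m)` has an
    -- entry at most `m` for `g` but a larger one for `g'`.
    have key : ∀ {g g' : ℕ → ℕ → ℕ}, IsPatternOf α.rowLen lam.rowLen g →
        IsPatternOf α.rowLen lam.rowLen g' → tableauOf g = tableauOf g' → g i m ≤ g' i m := by
      intro g g' hg hg' heq
      by_contra! hlt
      have h1 : tableauOf g (i, g' i m) ≤ m := tableauOf_le hlt
      have hs : 0 < tableauOf g' (i, g' i m) := by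
        rw [hg'.tableauOf_pos_iff, mem_skewCells_iff]
        have := hg'.monotone i (Nat.zero_le m)
        rw [hg'.zero] at this
        exact ⟨this, lt_of_lt_of_le hlt (hg.le_top i m)⟩
      have h2 := IsLRPattern.lt_of_tableauOf_pos hs
      rw [← heq] at h2
      have := hg'.monotone i h1
      simp only at h2
      omega
    exact le_antisymm (key hg hg' heq) (key hg' hg heq.symm)
  rw [SkewChar.lrCoeff]
  have := Set.ncard_le_ncard (s := {tableauOf g, tableauOf g'})
    (t := {T | SkewChar.IsLRTableau lam α ν T}) (by
      rintro T (rfl | rfl)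
      · exact hT
      · exact hT') (SkewChar.finite_isLRTableau lam α ν)
  rwa [Set.ncard_pair hdiff] at this

/-! ### Columns filled by runs of consecutive entries -/

/-- A filling of a column with top `t` by four runs of consecutive entries, starting in the rows
`t ≤ e₁ ≤ e₂ ≤ e₃` with the entries `1`, `v₁ + 1`, `v₂ + 1`, `v₃ + 1`. -/
def runFill (t e₁ v₁ e₂ v₂ e₃ v₃ i : ℕ) : ℕ :=
  if i < t then 0 else if i < e₁ then i - t + 1 else if i < e₂ then i - e₁ + 1 + v₁ else
    if i < e₃ then i - e₂ + 1 + v₂ else i - e₃ + 1 + v₃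

/-- The contribution of a column with bottom `b` and filling `F` to a pattern. -/
def colPattern (F : ℕ → ℕ) (b i m : ℕ) : ℕ :=
  if i < b ∧ F i ≤ m then 1 else 0

/-- Whether a run of consecutive entries, starting with `v + 1` in row `s` and ending above row `e`,
contains the entry `m + 1` above row `i`. -/
def runCount (s e v i m : ℕ) : ℕ :=
  if v ≤ m ∧ s + m < i + v ∧ s + m < e + v then 1 else 0

/-- Presents an indicator as a disjunction that `omega` can split; all counting of runs below
reduces to linear arithmetic this way. -/
theorem ite_one_zero_spec (P : Prop) [Decidable P] :
    P ∧ (if P then 1 else 0) = 1 ∨ ¬ P ∧ (if P then 1 else 0) = 0 := by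
  by_cases h : P <;> simp [h]

theorem colPattern_spec (F : ℕ → ℕ) (b i m : ℕ) :
    (i < b ∧ F i ≤ m) ∧ colPattern F b i m = 1 ∨ ¬ (i < b ∧ F i ≤ m) ∧ colPattern F b i m = 0 :=
  ite_one_zero_spec _

theorem runCount_spec (s e v i m : ℕ) :
    (v ≤ m ∧ s + m < i + v ∧ s + m < e + v) ∧ runCount s e v i m = 1 ∨
      ¬ (v ≤ m ∧ s + m < i + v ∧ s + m < e + v) ∧ runCount s e v i m = 0 :=
  ite_one_zero_spec _

theorem runCount_of_le {s e v i m : ℕ} (h : e ≤ s) : runCount s e v i m = 0 := by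
  have := runCount_spec s e v i m
  omega

theorem runCount_succ (s e v i m : ℕ) : runCount s e v (i + 1) m =
    runCount s e v i m + if v ≤ m ∧ s + m = i + v ∧ i < e then 1 else 0 := by
  have h1 := runCount_spec s e v i m
  have h2 := runCount_spec s e v (i + 1) m
  have h3 := ite_one_zero_spec (v ≤ m ∧ s + m = i + v ∧ i < e)
  omega

theorem colPattern_succ {t e₁ v₁ e₂ v₂ e₃ v₃ b : ℕ} (h₁ : t ≤ e₁) (h₂ : e₁ ≤ e₂) (h₃ : e₂ ≤ e₃)
    (h₄ : e₃ ≤ b) (i m : ℕ) :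
    colPattern (runFill t e₁ v₁ e₂ v₂ e₃ v₃) b i (m + 1) =
      colPattern (runFill t e₁ v₁ e₂ v₂ e₃ v₃) b i m +
      ((if 0 ≤ m ∧ t + m = i + 0 ∧ i < e₁ then 1 else 0) +
      (if v₁ ≤ m ∧ e₁ + m = i + v₁ ∧ i < e₂ then 1 else 0) +
      (if v₂ ≤ m ∧ e₂ + m = i + v₂ ∧ i < e₃ then 1 else 0) +
      (if v₃ ≤ m ∧ e₃ + m = i + v₃ ∧ i < b then 1 else 0)) := by
  -- `a1` to `a4`: the indicator of a run that does not meet row `i` vanishes, so at most one of the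
  -- four survives in each case below.
  have a1 : ¬ (i < t ∨ e₁ ≤ i) ∨
      (if 0 ≤ m ∧ t + m = i + 0 ∧ i < e₁ then 1 else 0) = 0 := by
    have := ite_one_zero_spec (0 ≤ m ∧ t + m = i + 0 ∧ i < e₁)
    omega
  have a2 : ¬ (i < e₁ ∨ e₂ ≤ i) ∨
      (if v₁ ≤ m ∧ e₁ + m = i + v₁ ∧ i < e₂ then 1 else 0) = 0 := by
    have := ite_one_zero_spec (v₁ ≤ m ∧ e₁ + m = i + v₁ ∧ i < e₂)
    omega
  have a3 : ¬ (i < e₂ ∨ e₃ ≤ i) ∨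
      (if v₂ ≤ m ∧ e₂ + m = i + v₂ ∧ i < e₃ then 1 else 0) = 0 := by
    have := ite_one_zero_spec (v₂ ≤ m ∧ e₂ + m = i + v₂ ∧ i < e₃)
    omega
  have a4 : ¬ (i < e₃ ∨ b ≤ i) ∨
      (if v₃ ≤ m ∧ e₃ + m = i + v₃ ∧ i < b then 1 else 0) = 0 := by
    have := ite_one_zero_spec (v₃ ≤ m ∧ e₃ + m = i + v₃ ∧ i < b)
    omega
  have c1 := colPattern_spec (runFill t e₁ v₁ e₂ v₂ e₃ v₃) b i m
  have c2 := colPattern_spec (runFill t e₁ v₁ e₂ v₂ e₃ v₃) b i (m + 1)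
  rcases lt_or_ge i t with h | h
  · have hF : runFill t e₁ v₁ e₂ v₂ e₃ v₃ i = 0 := by simp only [runFill, h, if_true]
    omega
  rcases lt_or_ge i e₁ with h' | h'
  · have hF : runFill t e₁ v₁ e₂ v₂ e₃ v₃ i = i - t + 1 := by
      simp only [runFill, not_lt.2 h, h', if_true, if_false]
    have := ite_one_zero_spec (0 ≤ m ∧ t + m = i + 0 ∧ i < e₁)
    omega
  rcases lt_or_ge i e₂ with h'' | h''
  · have hF : runFill t e₁ v₁ e₂ v₂ e₃ v₃ i = i - e₁ + 1 + v₁ := by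
      simp only [runFill, not_lt.2 h, not_lt.2 h', h'', if_true, if_false]
    have := ite_one_zero_spec (v₁ ≤ m ∧ e₁ + m = i + v₁ ∧ i < e₂)
    omega
  rcases lt_or_ge i e₃ with h₅ | h₅
  · have hF : runFill t e₁ v₁ e₂ v₂ e₃ v₃ i = i - e₂ + 1 + v₂ := by
      simp only [runFill, not_lt.2 h, not_lt.2 h', not_lt.2 h'', h₅, if_true, if_false]
    have := ite_one_zero_spec (v₂ ≤ m ∧ e₂ + m = i + v₂ ∧ i < e₃)
    omega
  · have hF : runFill t e₁ v₁ e₂ v₂ e₃ v₃ i = i - e₃ + 1 + v₃ := by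
      simp only [runFill, not_lt.2 h, not_lt.2 h', not_lt.2 h'', not_lt.2 h₅, if_false]
    have := ite_one_zero_spec (v₃ ≤ m ∧ e₃ + m = i + v₃ ∧ i < b)
    omega

theorem sum_colPattern_succ {t e₁ v₁ e₂ v₂ e₃ v₃ b : ℕ} (h₁ : t ≤ e₁) (h₂ : e₁ ≤ e₂) (h₃ : e₂ ≤ e₃)
    (h₄ : e₃ ≤ b) (i m : ℕ) :
    ∑ r ∈ range i, colPattern (runFill t e₁ v₁ e₂ v₂ e₃ v₃) b r (m + 1) =
      ∑ r ∈ range i, colPattern (runFill t e₁ v₁ e₂ v₂ e₃ v₃) b r m +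
      (runCount t e₁ 0 i m + runCount e₁ e₂ v₁ i m + runCount e₂ e₃ v₂ i m +
        runCount e₃ b v₃ i m) := by
  induction i with
  | zero =>
    have h1 := runCount_spec t e₁ 0 0 m
    have h2 := runCount_spec e₁ e₂ v₁ 0 m
    have h3 := runCount_spec e₂ e₃ v₂ 0 m
    have h4 := runCount_spec e₃ b v₃ 0 m
    simp only [range_zero, sum_empty]
    omega
  | succ i ih =>
    rw [sum_range_succ, sum_range_succ, ih]
    simp only [runCount_succ]
    have := colPattern_succ h₁ h₂ h₃ h₄ (v₁ := v₁) (v₂ := v₂) (v₃ := v₃) i m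
    omega

/-! ### Chains of runs -/

/-- The number of entries `m + 1` above row `i` that lie in a chain of three runs. -/
def chainCount (s₁ f₁ s₂ f₂ v₂ s₃ f₃ v₃ i m : ℕ) : ℕ :=
  runCount s₁ f₁ 0 i m + runCount s₂ f₂ v₂ i m + runCount s₃ f₃ v₃ i m

/-- Each run of the chain starts below the previous ones and continues their entries. -/
structure IsRunChain (s₁ f₁ s₂ f₂ v₂ s₃ f₃ v₃ : ℕ) : Prop where
  le₁ : s₁ ≤ f₁
  le₂ : s₂ ≤ f₂
  le₃ : s₃ ≤ f₃
  eq₂ : v₂ + s₁ = f₁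
  eq₃ : s₃ < f₃ → v₃ + s₂ = v₂ + f₂
  lt₂ : s₂ < f₂ → f₁ ≤ s₂
  lt₃ : s₃ < f₃ → f₁ ≤ s₃ ∧ f₂ ≤ s₃

theorem IsRunChain.count_succ_le {s₁ f₁ s₂ f₂ v₂ s₃ f₃ v₃ : ℕ}
    (h : IsRunChain s₁ f₁ s₂ f₂ v₂ s₃ f₃ v₃) (i m : ℕ) :
    chainCount s₁ f₁ s₂ f₂ v₂ s₃ f₃ v₃ (i + 1) (m + 1) ≤
      chainCount s₁ f₁ s₂ f₂ v₂ s₃ f₃ v₃ i m := by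
  obtain ⟨h₁, h₂, h₃, h₄, h₅, h₆, h₇⟩ := h
  unfold chainCount
  have h1 := runCount_spec s₁ f₁ 0 i m
  have h2 := runCount_spec s₂ f₂ v₂ i m
  have h3 := runCount_spec s₃ f₃ v₃ i m
  have h1' := runCount_spec s₁ f₁ 0 (i + 1) (m + 1)
  have h2' := runCount_spec s₂ f₂ v₂ (i + 1) (m + 1)
  have h3' := runCount_spec s₃ f₃ v₃ (i + 1) (m + 1)
  omega

/-- A chain of total length `n` uses each of `1, …, n` once. The bound on `i` is crude and only puts
row `i` below all runs. -/
theorem IsRunChain.count_eq {s₁ f₁ s₂ f₂ v₂ s₃ f₃ v₃ : ℕ}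
    (h : IsRunChain s₁ f₁ s₂ f₂ v₂ s₃ f₃ v₃) {i n : ℕ} (hi : f₁ + f₂ + f₃ ≤ i)
    (hn : n + s₁ + s₂ + s₃ = f₁ + f₂ + f₃) (m : ℕ) :
    chainCount s₁ f₁ s₂ f₂ v₂ s₃ f₃ v₃ i m = if m < n then 1 else 0 := by
  obtain ⟨h₁, h₂, h₃, h₄, h₅, h₆, h₇⟩ := h
  unfold chainCount
  have h1 := runCount_spec s₁ f₁ 0 i m
  have h2 := runCount_spec s₂ f₂ v₂ i m
  have h3 := runCount_spec s₃ f₃ v₃ i m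
  have h4 := ite_one_zero_spec (m < n)
  omega

/-! ### Patterns from families of columns -/

/-- A column filled by runs of consecutive entries. -/
structure RunColumn where
  t : ℕ
  e₁ : ℕ
  v₁ : ℕ
  e₂ : ℕ
  v₂ : ℕ
  e₃ : ℕ
  v₃ : ℕ
  b : ℕ

namespace RunColumn

/-- The entries of the column. -/
def fill (c : RunColumn) : ℕ → ℕ :=
  runFill c.t c.e₁ c.v₁ c.e₂ c.v₂ c.e₃ c.v₃

/-- The pattern of the column. -/
def pattern (c : RunColumn) : ℕ → ℕ → ℕ :=
  colPattern c.fill c.b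

/-- The number of entries `m + 1` above row `i`. -/
def count (c : RunColumn) (i m : ℕ) : ℕ :=
  runCount c.t c.e₁ 0 i m + runCount c.e₁ c.e₂ c.v₁ i m + runCount c.e₂ c.e₃ c.v₂ i m +
    runCount c.e₃ c.b c.v₃ i m

/-- The runs follow each other and the entries increase strictly. -/
structure IsValid (c : RunColumn) : Prop where
  le₁ : c.t ≤ c.e₁
  le₂ : c.e₁ ≤ c.e₂
  le₃ : c.e₂ ≤ c.e₃
  le₄ : c.e₃ ≤ c.b
  inc₁ : c.e₁ < c.e₂ → c.e₁ ≤ c.t + c.v₁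
  inc₂ : c.e₂ < c.e₃ → c.e₁ ≤ c.t + c.v₂ ∧ (c.e₁ < c.e₂ → c.e₂ + c.v₁ ≤ c.e₁ + c.v₂)
  inc₃ : c.e₃ < c.b → c.e₁ ≤ c.t + c.v₃ ∧ (c.e₁ < c.e₂ → c.e₂ + c.v₁ ≤ c.e₁ + c.v₃) ∧
    (c.e₂ < c.e₃ → c.e₃ + c.v₂ ≤ c.e₂ + c.v₃)

theorem pattern_strict {c : RunColumn} (h : c.IsValid) (i m : ℕ) :
    c.pattern (i + 1) (m + 1) ≤ c.pattern i m := by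
  obtain ⟨t, e₁, v₁, e₂, v₂, e₃, v₃, b⟩ := c
  obtain ⟨h₁, h₂, h₃, h₄, h₅, h₆, h₇⟩ := h
  simp only at *
  simp only [pattern, fill]
  have key : i + 1 < b → t ≤ i → runFill t e₁ v₁ e₂ v₂ e₃ v₃ i < runFill t e₁ v₁ e₂ v₂ e₃ v₃ (i + 1) := by
    intro hb ht
    unfold runFill
    split_ifs <;> omega
  have h0 : i < t → runFill t e₁ v₁ e₂ v₂ e₃ v₃ i = 0 := fun h => by
    unfold runFill
    rw [if_pos h]
  have c1 := colPattern_spec (runFill t e₁ v₁ e₂ v₂ e₃ v₃) b (i + 1) (m + 1)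
  have c2 := colPattern_spec (runFill t e₁ v₁ e₂ v₂ e₃ v₃) b i m
  omega

theorem pattern_mono (c : RunColumn) (i m : ℕ) : c.pattern i m ≤ c.pattern i (m + 1) := by
  simp only [pattern, colPattern]
  split_ifs <;> omega

theorem pattern_zero {c : RunColumn} (h : c.IsValid) (i : ℕ) :
    c.pattern i 0 = if i < c.t then 1 else 0 := by
  have := h.le₁
  have := h.le₂
  have := h.le₃
  have := h.le₄
  simp only [pattern, colPattern, fill, runFill]
  split_ifs <;> omega

theorem pattern_top {c : RunColumn} (i m : ℕ) (hm : c.b + c.v₁ + c.v₂ + c.v₃ + 1 ≤ m) :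
    c.pattern i m = if i < c.b then 1 else 0 := by
  have : i < c.b → c.fill i ≤ m := fun h => by
    simp only [fill, runFill]
    split_ifs <;> omega
  simp only [pattern, colPattern]
  split_ifs <;> omega

theorem sum_pattern_succ {c : RunColumn} (h : c.IsValid) (i m : ℕ) :
    ∑ r ∈ range i, c.pattern r (m + 1) = ∑ r ∈ range i, c.pattern r m + c.count i m :=
  sum_colPattern_succ h.le₁ h.le₂ h.le₃ h.le₄ i m

end RunColumn

/-- Neighbouring columns need not be compared: the sum only records how many entries of each row are
at most `m`, which amounts to sorting every row. Strictness survives because it holds column by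
column, and only the lattice condition involves all columns together. -/
theorem isPatternOf_sum_columns {n : ℕ} (c : Fin n → RunColumn) (hc : ∀ j, (c j).IsValid)
    (hlat : ∀ i m, ∑ j, (c j).count (i + 1) (m + 1) ≤ ∑ j, (c j).count i m) :
    IsPatternOf (fun i => ∑ j, if i < (c j).t then 1 else 0)
      (fun i => ∑ j, if i < (c j).b then 1 else 0) (fun i m => ∑ j, (c j).pattern i m) where
  mono i m := sum_le_sum fun j _ => (c j).pattern_mono i m
  strict i m := sum_le_sum fun j _ => RunColumn.pattern_strict (hc j) i m
  lattice i m := by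
    have h1 : ∀ i m, ∑ r ∈ range i, ∑ j, (c j).pattern r (m + 1) =
        ∑ r ∈ range i, ∑ j, (c j).pattern r m + ∑ j, (c j).count i m := fun i m => by
      rw [sum_comm, sum_comm (s := range i), ← sum_add_distrib]
      exact sum_congr rfl fun j _ => RunColumn.sum_pattern_succ (hc j) i m
    have := h1 (i + 1) (m + 1)
    have := h1 i m
    have := hlat i m
    simp only [add_assoc, one_add_one_eq_two] at *
    omega
  zero i := sum_congr rfl fun j _ => RunColumn.pattern_zero (hc j) i
  top := ⟨∑ j, ((c j).b + (c j).v₁ + (c j).v₂ + (c j).v₃ + 1), fun i m hm =>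
    sum_congr rfl fun j _ => RunColumn.pattern_top i m (le_trans
      (single_le_sum (f := fun j => (c j).b + (c j).v₁ + (c j).v₂ + (c j).v₃ + 1)
        (fun _ _ => Nat.zero_le _) (mem_univ j)) hm)⟩

/-- The total size at level `m` is the size of the inner shape plus the numbers of entries `1, …,
m`, so equal tops and equal counts give equal contents. -/
theorem hasTwoPatterns_of_columns {n : ℕ} (c c' : Fin n → RunColumn)
    (hc : ∀ j, (c j).IsValid) (hc' : ∀ j, (c' j).IsValid)
    (ht : ∀ j, (c' j).t = (c j).t) (hb : ∀ j, (c' j).b = (c j).b)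
    (hlat : ∀ i m, ∑ j, (c j).count (i + 1) (m + 1) ≤ ∑ j, (c j).count i m)
    (hlat' : ∀ i m, ∑ j, (c' j).count (i + 1) (m + 1) ≤ ∑ j, (c' j).count i m)
    (hcount : ∃ K₀, ∀ K, K₀ ≤ K → ∀ m, ∑ j, (c j).count K m = ∑ j, (c' j).count K m)
    (hne : ∃ i m, ∑ j, (c j).pattern i m ≠ ∑ j, (c' j).pattern i m) :
    HasTwoPatterns (fun i => ∑ j, if i < (c j).t then 1 else 0)
      (fun i => ∑ j, if i < (c j).b then 1 else 0) := by
  refine ⟨fun i m => ∑ j, (c j).pattern i m, fun i m => ∑ j, (c' j).pattern i m,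
    isPatternOf_sum_columns c hc hlat, ?_, ?_, ?_⟩
  · have := isPatternOf_sum_columns c' hc' hlat'
    simpa only [ht, hb] using this
  · obtain ⟨K₀, hK⟩ := hcount
    refine ⟨K₀, fun K hK₀ m => ?_⟩
    rw [sum_comm, sum_comm (s := range K)]
    induction m with
    | zero => simp only [RunColumn.pattern_zero (hc _), RunColumn.pattern_zero (hc' _), ht]
    | succ m ih =>
      simp only [RunColumn.sum_pattern_succ (hc _), RunColumn.sum_pattern_succ (hc' _),
        sum_add_distrib, ih, hK K hK₀ m]
  · obtain ⟨i, m, h⟩ := hne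
    exact fun heq => h (congrFun (congrFun heq i) m)

/-- The column filled with `1, 2, 3, …`. -/
def RunColumn.plain (t b : ℕ) : RunColumn :=
  ⟨t, b, 0, b, 0, b, 0, b⟩

theorem RunColumn.plain_isValid {t b : ℕ} (h : t ≤ b) : (RunColumn.plain t b).IsValid := by
  constructor <;> simp only [RunColumn.plain] <;> omega

/-- A single run is a chain by itself. This is the filler for the columns that are not selected. -/
theorem isPatternOf_plain {t b : ℕ} (h : t ≤ b) :
    IsPatternOf (fun i => if i < t then 1 else 0) (fun i => if i < b then 1 else 0)
      (RunColumn.plain t b).pattern := by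
  have := isPatternOf_sum_columns (n := 1) (fun _ => RunColumn.plain t b)
    (fun _ => RunColumn.plain_isValid h) (fun i m => by
      simp only [RunColumn.count, RunColumn.plain, univ_unique, sum_const, card_singleton, one_smul,
        runCount_of_le le_rfl]
      have h1 := runCount_spec t b 0 i m
      have h2 := runCount_spec t b 0 (i + 1) (m + 1)
      omega)
  simp only [RunColumn.plain, univ_unique, sum_const, card_singleton, one_smul] at this
  exact this

theorem runFill_of_lt {t e₁ v₁ e₂ v₂ e₃ v₃ i : ℕ} (h : i < e₁) :
    runFill t e₁ v₁ e₂ v₂ e₃ v₃ i = i + 1 - t := by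
  unfold runFill
  split_ifs <;> omega

theorem runFill_of_le_of_lt {t e₁ v₁ e₂ v₂ e₃ v₃ i : ℕ} (h : t ≤ e₁) (h₁ : e₁ ≤ i) (h₂ : i < e₂) :
    runFill t e₁ v₁ e₂ v₂ e₃ v₃ i = i + 1 - e₁ + v₁ := by
  unfold runFill
  split_ifs <;> omega

theorem isRunChain_single {s f v s' v' : ℕ} (h : s ≤ f) (hv : v + s = f) :
    IsRunChain s f s' s' v s' s' v' := by
  constructor <;> omega

theorem colPattern_eq_one {F : ℕ → ℕ} {b i m : ℕ} (h₁ : i < b) (h₂ : F i ≤ m) :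
    colPattern F b i m = 1 :=
  if_pos ⟨h₁, h₂⟩

theorem colPattern_eq_zero {F : ℕ → ℕ} {b i m : ℕ} (h : m < F i) :
    colPattern F b i m = 0 :=
  if_neg fun h' => not_le.2 h h'.2

theorem colPattern_congr {F F' : ℕ → ℕ} {b i m : ℕ} (h : F i = F' i) :
    colPattern F b i m = colPattern F' b i m := by
  simp only [colPattern, h]

/-! ### Three columns with distinct tops and distinct bottoms -/

section

variable {t₁ t₂ t₃ b₁ b₂ b₃ : ℕ}

/-- A filling of three columns with distinct tops and distinct bottoms. -/
def threeColumns (t₁ t₂ t₃ b₁ b₂ b₃ y u s : ℕ) : Fin 3 → RunColumn :=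
  ![⟨t₁, t₁ + u, y, t₁ + s, b₃ - t₃ + (b₂ - t₂) - y, b₁, 0, b₁⟩,
    ⟨t₂, t₂ + y, b₃ - t₃, b₂, 0, b₂, 0, b₂⟩, RunColumn.plain t₃ b₃]

/-- The first chain takes the whole third column, the lower run of the second and the last run of
the first. The second chain takes the upper run of the second column and the middle run of the
first, and the third chain is the top run of the first column. -/
theorem threeColumns_count (y u s i m : ℕ) :
    ∑ j, (threeColumns t₁ t₂ t₃ b₁ b₂ b₃ y u s j).count i m =
      chainCount t₃ b₃ (t₂ + y) b₂ (b₃ - t₃) (t₁ + s) b₁ (b₃ - t₃ + (b₂ - t₂) - y) i m +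
      chainCount t₂ (t₂ + y) (t₁ + u) (t₁ + s) y b₁ b₁ 0 i m +
      chainCount t₁ (t₁ + u) b₁ b₁ u b₁ b₁ 0 i m := by
  simp only [threeColumns, Fin.sum_univ_three, Matrix.cons_val, RunColumn.plain, chainCount,
    RunColumn.count, runCount_of_le le_rfl]
  omega

theorem threeColumns_chains {y u s : ℕ} (h₃ : t₃ < b₃)
    (hy : y ≤ b₂ - t₂) (hus : u ≤ s) (hs : t₁ + s ≤ b₁)
    (hb₂ : b₃ ≤ t₂ + y) (hb₁ : b₂ ≤ t₁ + s) (hu : u < s → t₂ + y ≤ t₁ + u) (ht : t₂ < b₂) :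
    IsRunChain t₃ b₃ (t₂ + y) b₂ (b₃ - t₃) (t₁ + s) b₁ (b₃ - t₃ + (b₂ - t₂) - y) ∧
      IsRunChain t₂ (t₂ + y) (t₁ + u) (t₁ + s) y b₁ b₁ 0 ∧
      IsRunChain t₁ (t₁ + u) b₁ b₁ u b₁ b₁ 0 := by
  refine ⟨?_, ?_, isRunChain_single (by omega) (by omega)⟩ <;> constructor <;> omega

theorem threeColumns_isValid {y u s : ℕ} (h₃ : t₃ < b₃)
    (hy : y ≤ b₂ - t₂) (hy' : y ≤ b₃ - t₃) (hus : u ≤ s) (hs : t₁ + s ≤ b₁)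
    (huy : u < s → u ≤ y ∧ 2 * y + s ≤ b₃ - t₃ + (b₂ - t₂) + u) (hu : u + y ≤ b₃ - t₃ + (b₂ - t₂))
    (ht : t₂ < b₂) (j : Fin 3) : (threeColumns t₁ t₂ t₃ b₁ b₂ b₃ y u s j).IsValid := by
  fin_cases j
  · constructor <;> simp only [threeColumns, Fin.zero_eta, Matrix.cons_val] <;> omega
  · constructor <;> simp only [threeColumns, Fin.mk_one, Matrix.cons_val] <;> omega
  · exact RunColumn.plain_isValid h₃.le

theorem hasTwoPatterns_three_columns (ht₁ : t₂ < t₁) (ht₂ : t₃ < t₂) (hb₁ : b₂ < b₁) (hb₂ : b₃ < b₂)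
    (h₁ : t₁ < b₁) (h₂ : t₂ < b₂) (h₃ : t₃ < b₃) :
    HasTwoPatterns
      (fun i => (if i < t₁ then 1 else 0) + (if i < t₂ then 1 else 0) + (if i < t₃ then 1 else 0))
      (fun i => (if i < b₁ then 1 else 0) + (if i < b₂ then 1 else 0) +
        (if i < b₃ then 1 else 0)) := by
  -- `y` and `o` are the numbers of rows shared by adjacent columns (`0` if there are none), the
  -- least cuts for which the lower runs start below the column to the right. The strict
  -- inequalities leave room for one more box, used for `s = o + 1` in one filling and for `y + 1`
  -- in the other; the chain lengths depend only on `y + s` and `u`.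
  obtain ⟨y, hy⟩ : ∃ y, y = b₃ - t₂ := ⟨_, rfl⟩
  obtain ⟨o, ho⟩ : ∃ o, o = b₂ - t₁ := ⟨_, rfl⟩
  obtain ⟨u, hu⟩ : ∃ u, u = min o y := ⟨_, rfl⟩
  obtain ⟨hA, hB, hC⟩ := threeColumns_chains (t₁ := t₁) (b₁ := b₁) (b₂ := b₂) (t₂ := t₂) (y := y)
    (u := u) (s := o + 1) h₃ (by omega) (by omega) (by omega) (by omega) (by omega) (by omega) h₂
  obtain ⟨hA', hB', hC'⟩ := threeColumns_chains (t₁ := t₁) (b₁ := b₁) (b₂ := b₂) (t₂ := t₂)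
    (y := y + 1) (u := u) (s := o) h₃ (by omega) (by omega) (by omega) (by omega) (by omega)
    (by omega) h₂
  have key := hasTwoPatterns_of_columns (threeColumns t₁ t₂ t₃ b₁ b₂ b₃ y u (o + 1))
    (threeColumns t₁ t₂ t₃ b₁ b₂ b₃ (y + 1) u o)
    (threeColumns_isValid h₃ (by omega) (by omega) (by omega) (by omega) (by omega) (by omega) h₂)
    (threeColumns_isValid h₃ (by omega) (by omega) (by omega) (by omega) (by omega) (by omega) h₂)
    (fun j => by fin_cases j <;> rfl) (fun j => by fin_cases j <;> rfl)
    (fun i m => by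
      rw [threeColumns_count, threeColumns_count]
      exact add_le_add (add_le_add (hA.count_succ_le i m) (hB.count_succ_le i m))
        (hC.count_succ_le i m))
    (fun i m => by
      rw [threeColumns_count, threeColumns_count]
      exact add_le_add (add_le_add (hA'.count_succ_le i m) (hB'.count_succ_le i m))
        (hC'.count_succ_le i m))
    ⟨3 * (b₁ + b₂ + t₁ + t₂ + u + o + y + 2), fun K hK m => by
      rw [threeColumns_count, threeColumns_count,
        hA.count_eq (n := b₃ + b₂ + b₁ - t₃ - (t₂ + y) - (t₁ + (o + 1))) (by omega) (by omega),
        hA'.count_eq (n := b₃ + b₂ + b₁ - t₃ - (t₂ + y) - (t₁ + (o + 1))) (by omega) (by omega),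
        hB.count_eq (n := y + o + 1 - u) (by omega) (by omega),
        hB'.count_eq (n := y + o + 1 - u) (by omega) (by omega),
        hC.count_eq (n := u) (by omega) (by omega)]⟩
    -- In row `t₂ + y` the second column has `b₃ - t₃ + 1 > y + 1` in one filling and `y + 1` in the
    -- other; the first column is there still in its inner part or top run, common to both.
    ⟨t₂ + y, y + 1, by
      simp only [threeColumns, Fin.sum_univ_three, Matrix.cons_val, RunColumn.pattern,
        RunColumn.fill]
      rw [colPattern_eq_zero (b := b₂) (F := runFill t₂ (t₂ + y) _ _ _ _ _)
          (by rw [runFill_of_le_of_lt] <;> omega),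
        colPattern_eq_one (b := b₂) (F := runFill t₂ (t₂ + (y + 1)) _ _ _ _ _) (by omega)
          (by rw [runFill_of_lt] <;> omega),
        colPattern_congr (b := b₁) (F := runFill t₁ _ _ _ (b₃ - t₃ + (b₂ - t₂) - y) _ _)
          (F' := runFill t₁ (t₁ + u) (y + 1) (t₁ + o) (b₃ - t₃ + (b₂ - t₂) - (y + 1)) b₁ 0)
          (by rw [runFill_of_lt, runFill_of_lt] <;> omega)]
      omega⟩
  simp only [Fin.sum_univ_three] at key
  exact key

end

/-! ### Four columns, with a common bottom on one side and a common top on the other, or conversely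
-/

section

variable {t t₁ t₂ t₃ t₄ b b₁ b₂ b₃ b₄ : ℕ}

/-- A filling of four columns, two with the same bottom and two with the same top. -/
def fourColumnsBottom (t t₁ t₂ b b₃ b₄ r q x z : ℕ) : Fin 4 → RunColumn :=
  ![⟨t₁, t₁ + x, r, t₁ + x + z, b₄ - t + q, b, 0, b⟩,
    ⟨t₂, t₂ + r, b₄ - t, t₂ + r + q, b₃ - t, b, 0, b⟩, RunColumn.plain t b₃, RunColumn.plain t b₄]

/-- The chains are: third column, then the last run of the second; fourth column, then the middle
run of the second and the last run of the first; top run of the second, then the middle run of the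
first; top run of the first. -/
theorem fourColumnsBottom_count (r q x z i m : ℕ) :
    ∑ j, (fourColumnsBottom t t₁ t₂ b b₃ b₄ r q x z j).count i m =
      chainCount t b₃ (t₂ + r + q) b (b₃ - t) b b 0 i m +
      chainCount t b₄ (t₂ + r) (t₂ + r + q) (b₄ - t) (t₁ + x + z) b (b₄ - t + q) i m +
      chainCount t₂ (t₂ + r) (t₁ + x) (t₁ + x + z) r b b 0 i m +
      chainCount t₁ (t₁ + x) b b x b b 0 i m := by
  simp only [fourColumnsBottom, Fin.sum_univ_four, Matrix.cons_val, RunColumn.plain, chainCount,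
    RunColumn.count, runCount_of_le le_rfl]
  omega

theorem fourColumnsBottom_chains {r q x z : ℕ} (h₃ : t < b₃) (h₄ : t < b₄)
    (hrq : t₂ + r + q ≤ b) (hxz : t₁ + x + z ≤ b)
    (hA : b₃ ≤ t₂ + r + q) (hB : b₄ ≤ t₂ + r)
    (hB' : t₁ + x + z < b → t₂ + r + q ≤ t₁ + x + z) (hC : 0 < z → t₂ + r ≤ t₁ + x) :
    IsRunChain t b₃ (t₂ + r + q) b (b₃ - t) b b 0 ∧
      IsRunChain t b₄ (t₂ + r) (t₂ + r + q) (b₄ - t) (t₁ + x + z) b (b₄ - t + q) ∧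
      IsRunChain t₂ (t₂ + r) (t₁ + x) (t₁ + x + z) r b b 0 ∧
      IsRunChain t₁ (t₁ + x) b b x b b 0 := by
  refine ⟨?_, ?_, ?_, isRunChain_single (by omega) (by omega)⟩ <;> constructor <;> omega

theorem fourColumnsBottom_isValid {r q x z : ℕ} (h₃ : t < b₃) (h₄ : t < b₄)
    (hrq : t₂ + r + q ≤ b) (hxz : t₁ + x + z ≤ b)
    (hr : 0 < q → r ≤ b₄ - t) (hr' : r ≤ b₃ - t) (hq : b₄ - t + q ≤ b₃ - t)
    (hx : t₁ + x < b → x ≤ r) (hz : r + z ≤ b₄ - t + q ∨ t₁ + x + z = b)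
    (hx' : x ≤ b₄ - t + q) (j : Fin 4) :
    (fourColumnsBottom t t₁ t₂ b b₃ b₄ r q x z j).IsValid := by
  fin_cases j
  · constructor <;> simp only [fourColumnsBottom, Fin.zero_eta, Matrix.cons_val] <;> omega
  · constructor <;> simp only [fourColumnsBottom, Fin.mk_one, Matrix.cons_val] <;> omega
  · exact RunColumn.plain_isValid h₃.le
  · exact RunColumn.plain_isValid h₄.le

theorem hasTwoPatterns_four_columns_bottom (ht₁ : t₂ < t₁) (ht₂ : t < t₂) (hb₁ : b₃ < b)
    (hb₂ : b₄ < b₃) (h₁ : t₁ < b) (h₄ : t < b₄) :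
    HasTwoPatterns
      (fun i => (if i < t₁ then 1 else 0) + (if i < t₂ then 1 else 0) + (if i < t then 1 else 0) +
        (if i < t then 1 else 0))
      (fun i => (if i < b then 1 else 0) + (if i < b then 1 else 0) + (if i < b₃ then 1 else 0) +
        (if i < b₄ then 1 else 0)) := by
  -- The cuts `r` and `r + 1 + q` clear the bottoms of the fourth and third columns. `p` and `w` are
  -- the lengths of the last runs of the second and first columns in the first filling; `w ≤ p` puts
  -- the latter no higher than the former, and `w > 0` allows `z + 1` in the second filling. Passing
  -- from `(r + 1, q, z)` to `(r, q + 1, z + 1)` keeps all chain lengths.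
  obtain ⟨r, hr⟩ : ∃ r, r = b₄ - t₂ := ⟨_, rfl⟩
  obtain ⟨q, hq⟩ : ∃ q, q = b₃ - t₂ - (r + 1) := ⟨_, rfl⟩
  obtain ⟨p, hp⟩ : ∃ p, p = b - t₂ - (r + 1) - q := ⟨_, rfl⟩
  obtain ⟨x, hx⟩ : ∃ x, x = min r (b - t₁ - 1) := ⟨_, rfl⟩
  obtain ⟨w, hw⟩ : ∃ w, w = min p (b - t₁ - x) := ⟨_, rfl⟩
  obtain ⟨z, hz⟩ : ∃ z, z = b - t₁ - x - w := ⟨_, rfl⟩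
  have h₃ : t < b₃ := h₄.trans hb₂
  obtain ⟨hA, hB, hC, hD⟩ := fourColumnsBottom_chains (t := t) (t₁ := t₁) (t₂ := t₂) (b := b)
    (r := r + 1) (q := q) (x := x) (z := z) h₃ h₄ (by omega) (by omega) (by omega) (by omega)
    (by omega) (by omega)
  obtain ⟨hA', hB', hC', hD'⟩ := fourColumnsBottom_chains (t := t) (t₁ := t₁) (t₂ := t₂) (b := b)
    (r := r) (q := q + 1) (x := x) (z := z + 1) h₃ h₄ (by omega) (by omega) (by omega) (by omega)
    (by omega) (by omega)
  have key := hasTwoPatterns_of_columns (fourColumnsBottom t t₁ t₂ b b₃ b₄ (r + 1) q x z)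
    (fourColumnsBottom t t₁ t₂ b b₃ b₄ r (q + 1) x (z + 1))
    (fourColumnsBottom_isValid h₃ h₄ (by omega) (by omega) (by omega) (by omega) (by omega)
      (by omega) (by omega) (by omega))
    (fourColumnsBottom_isValid h₃ h₄ (by omega) (by omega) (by omega) (by omega) (by omega)
      (by omega) (by omega) (by omega))
    (fun j => by fin_cases j <;> rfl) (fun j => by fin_cases j <;> rfl)
    (fun i m => by
      rw [fourColumnsBottom_count, fourColumnsBottom_count]
      exact add_le_add (add_le_add (add_le_add (hA.count_succ_le i m) (hB.count_succ_le i m))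
        (hC.count_succ_le i m)) (hD.count_succ_le i m))
    (fun i m => by
      rw [fourColumnsBottom_count, fourColumnsBottom_count]
      exact add_le_add (add_le_add (add_le_add (hA'.count_succ_le i m) (hB'.count_succ_le i m))
        (hC'.count_succ_le i m)) (hD'.count_succ_le i m))
    ⟨3 * (b + t₁ + t₂ + r + q + x + z + 2), fun K hK m => by
      rw [fourColumnsBottom_count, fourColumnsBottom_count,
        hA.count_eq (n := b₃ + b - t - (t₂ + r + 1 + q)) (by omega) (by omega),
        hA'.count_eq (n := b₃ + b - t - (t₂ + r + 1 + q)) (by omega) (by omega),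
        hB.count_eq (n := b₄ - t + q + (b - t₁ - x - z)) (by omega) (by omega),
        hB'.count_eq (n := b₄ - t + q + (b - t₁ - x - z)) (by omega) (by omega),
        hC.count_eq (n := r + 1 + z) (by omega) (by omega),
        hC'.count_eq (n := r + 1 + z) (by omega) (by omega)]⟩
    ⟨t₂ + r, r + 1, by
      simp only [fourColumnsBottom, Fin.sum_univ_four, Matrix.cons_val, RunColumn.pattern,
        RunColumn.fill]
      rw [colPattern_eq_one (b := b) (F := runFill t₂ (t₂ + (r + 1)) _ _ _ _ _) (by omega)
          (by rw [runFill_of_lt] <;> omega),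
        colPattern_eq_zero (b := b) (F := runFill t₂ (t₂ + r) _ _ _ _ _)
          (by rw [runFill_of_le_of_lt] <;> omega),
        colPattern_congr (b := b) (F := runFill t₁ _ (r + 1) _ _ _ _)
          (F' := runFill t₁ (t₁ + x) r (t₁ + x + (z + 1)) (b₄ - t + (q + 1)) b 0)
          (by rw [runFill_of_lt, runFill_of_lt] <;> omega)]
      omega⟩
  simp only [Fin.sum_univ_four] at key
  exact key

theorem hasTwoPatterns_four_columns_top (ht₁ : t₃ < t) (ht₂ : t₄ < t₃) (hb₁ : b₂ < b₁)
    (hb₂ : b < b₂) (h₂ : t < b₂) (h₃ : t₃ < b) :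
    HasTwoPatterns
      (fun i => (if i < t then 1 else 0) + (if i < t then 1 else 0) + (if i < t₃ then 1 else 0) +
        (if i < t₄ then 1 else 0))
      (fun i => (if i < b₁ then 1 else 0) + (if i < b₂ then 1 else 0) + (if i < b then 1 else 0) +
        (if i < b then 1 else 0)) := by
  obtain ⟨o, ho⟩ : ∃ o, o = b - t := ⟨_, rfl⟩
  obtain ⟨p, hp⟩ : ∃ p, p = b₂ - t - o := ⟨_, rfl⟩
  -- The first column has a single box `o + 1` in row `t + o`, so that a chain can pass from row `t
  -- + o` of the second column to row `t + o + 1` of the first. In `c'` the chain of the third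
  -- column does so, while in `c` it stays in the first column; the chain of the fourth column makes
  -- up for the exchanged box.
  let c : Fin 4 → RunColumn :=
    ![⟨t, t + o, o, t + o + 1, b - t₃, b₂ + 1, b - t₄ + p, b₁⟩,
      ⟨t, t + o, b - t₄, b₂, 0, b₂, 0, b₂⟩, RunColumn.plain t₃ b, RunColumn.plain t₄ b]
  let c' : Fin 4 → RunColumn :=
    ![⟨t, t + o, o, t + o + 1, b - t₃ + 1, b₂, b - t₄ + p - 1, b₁⟩,
      ⟨t, t + o, b - t₃, t + o + 1, b - t₄, b₂, 0, b₂⟩, RunColumn.plain t₃ b, RunColumn.plain t₄ b]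
  have hcount : ∀ i m, ∑ j, (c j).count i m =
      chainCount t₄ b (t + o) b₂ (b - t₄) (b₂ + 1) b₁ (b - t₄ + p) i m +
      chainCount t₃ b (t + o + 1) (b₂ + 1) (b - t₃) b₁ b₁ 0 i m +
      chainCount t (t + o) (t + o) (t + o + 1) o b₁ b₁ 0 i m +
      chainCount t (t + o) b₁ b₁ o b₁ b₁ 0 i m := fun i m => by
    simp only [c, Fin.sum_univ_four, Matrix.cons_val, RunColumn.plain, chainCount,
      RunColumn.count, runCount_of_le le_rfl]
    omega
  have hcount' : ∀ i m, ∑ j, (c' j).count i m =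
      chainCount t₄ b (t + o + 1) b₂ (b - t₄) b₂ b₁ (b - t₄ + p - 1) i m +
      chainCount t₃ b (t + o) (t + o + 1) (b - t₃) (t + o + 1) b₂ (b - t₃ + 1) i m +
      chainCount t (t + o) (t + o) (t + o + 1) o b₁ b₁ 0 i m +
      chainCount t (t + o) b₁ b₁ o b₁ b₁ 0 i m := fun i m => by
    simp only [c', Fin.sum_univ_four, Matrix.cons_val, RunColumn.plain, chainCount,
      RunColumn.count, runCount_of_le le_rfl]
    omega
  have hA : IsRunChain t₄ b (t + o) b₂ (b - t₄) (b₂ + 1) b₁ (b - t₄ + p) := by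
    constructor <;> omega
  have hB : IsRunChain t₃ b (t + o + 1) (b₂ + 1) (b - t₃) b₁ b₁ 0 := by
    constructor <;> omega
  have hC : IsRunChain t (t + o) (t + o) (t + o + 1) o b₁ b₁ 0 := by
    constructor <;> omega
  have hD : IsRunChain t (t + o) b₁ b₁ o b₁ b₁ 0 := isRunChain_single (by omega) (by omega)
  have hA' : IsRunChain t₄ b (t + o + 1) b₂ (b - t₄) b₂ b₁ (b - t₄ + p - 1) := by
    constructor <;> omega
  have hB' : IsRunChain t₃ b (t + o) (t + o + 1) (b - t₃) (t + o + 1) b₂ (b - t₃ + 1) := by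
    constructor <;> omega
  have hc : ∀ j, (c j).IsValid := fun j => by
    fin_cases j
    · constructor <;> simp only [c, Fin.zero_eta, Matrix.cons_val] <;> omega
    · constructor <;> simp only [c, Fin.mk_one, Matrix.cons_val] <;> omega
    · exact RunColumn.plain_isValid h₃.le
    · exact RunColumn.plain_isValid (ht₂.trans h₃).le
  have hc' : ∀ j, (c' j).IsValid := fun j => by
    fin_cases j
    · constructor <;> simp only [c', Fin.zero_eta, Matrix.cons_val] <;> omega
    · constructor <;> simp only [c', Fin.mk_one, Matrix.cons_val] <;> omega
    · exact RunColumn.plain_isValid h₃.le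
    · exact RunColumn.plain_isValid (ht₂.trans h₃).le
  have key := hasTwoPatterns_of_columns c c' hc hc'
    (fun j => by fin_cases j <;> rfl) (fun j => by fin_cases j <;> rfl)
    (fun i m => by
      rw [hcount, hcount]
      exact add_le_add (add_le_add (add_le_add (hA.count_succ_le i m) (hB.count_succ_le i m))
        (hC.count_succ_le i m)) (hD.count_succ_le i m))
    (fun i m => by
      rw [hcount', hcount']
      exact add_le_add (add_le_add (add_le_add (hA'.count_succ_le i m) (hB'.count_succ_le i m))
        (hC.count_succ_le i m)) (hD.count_succ_le i m))
    ⟨3 * (b₁ + b₂ + t + o + p + 2), fun K hK m => by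
      rw [hcount, hcount',
        hA.count_eq (n := b - t₄ + p + b₁ - b₂ - 1) (by omega) (by omega),
        hA'.count_eq (n := b - t₄ + p + b₁ - b₂ - 1) (by omega) (by omega),
        hB.count_eq (n := b - t₃ + p) (by omega) (by omega),
        hB'.count_eq (n := b - t₃ + p) (by omega) (by omega)]⟩
    -- In row `t + o` the first column has `o + 1` in both fillings, while the second has `b - t₄ +
    -- 1` in `c` and the smaller `b - t₃ + 1` in `c'`.
    ⟨t + o, b - t₃ + 1, by
      simp only [c, c', Fin.sum_univ_four, Matrix.cons_val, RunColumn.pattern,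
        RunColumn.fill]
      rw [colPattern_eq_zero (b := b₂) (F := runFill t (t + o) (b - t₄) _ _ _ _)
          (by rw [runFill_of_le_of_lt] <;> omega),
        colPattern_eq_one (b := b₂) (F := runFill t (t + o) (b - t₃) _ _ _ _) (by omega)
          (by rw [runFill_of_le_of_lt] <;> omega),
        colPattern_congr (b := b₁) (F := runFill t _ _ _ (b - t₃) _ _)
          (F' := runFill t (t + o) o (t + o + 1) (b - t₃ + 1) b₂ (b - t₄ + p - 1))
          (by rw [runFill_of_le_of_lt, runFill_of_le_of_lt] <;> omega)]
      omega⟩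
  simp only [Fin.sum_univ_four] at key
  exact key

end

/-! ### Columns of a connected skew diagram -/

theorem YoungDiagram.sum_range_colLen (μ : YoungDiagram) {N : ℕ} (hN : μ.rowLen 0 ≤ N) (i : ℕ) :
    ∑ j ∈ range N, (if i < μ.colLen j then 1 else 0) = μ.rowLen i := by
  rw [← card_filter]
  have : (range N).filter (fun j => i < μ.colLen j) = range (μ.rowLen i) := by
    ext j
    have := μ.rowLen_anti 0 i (Nat.zero_le i)
    simp only [mem_filter, mem_range, ← YoungDiagram.mem_iff_lt_colLen,
      YoungDiagram.mem_iff_lt_rowLen]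
    omega
  rw [this, card_range]

section

variable {lam α : YoungDiagram}

theorem colLen_mono (hsub : α ≤ lam) (j : ℕ) : α.colLen j ≤ lam.colLen j := by
  by_contra! h
  have h1 : (lam.colLen j, j) ∈ lam := hsub (YoungDiagram.mem_iff_lt_colLen.2 h)
  have := YoungDiagram.mem_iff_lt_colLen.1 h1
  omega

/-- In a connected skew diagram no column is empty. -/
theorem colLen_lt_colLen (hsub : α ≤ lam) (hrow : α.rowLen 0 < lam.rowLen 0)
    (hcol : α.colLen 0 < lam.colLen 0)
    (hconn : SkewChar.IsConnectedDiagram (SkewChar.skewCells lam α)) {j : ℕ}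
    (hj : j < lam.rowLen 0) : α.colLen j < lam.colLen j := by
  by_contra! hle
  have heq := le_antisymm hle (colLen_mono hsub j)
  have hmem : ∀ c : ℕ × ℕ, c ∈ SkewChar.skewCells lam α ↔
      c.1 < lam.colLen c.2 ∧ α.colLen c.2 ≤ c.1 := fun c => by
    obtain ⟨i, k⟩ := c
    simp [SkewChar.skewCells, YoungDiagram.mem_iff_lt_colLen]
  have h0 : ∀ k, lam.rowLen 0 ≤ k + 1 → k < lam.rowLen 0 → α.colLen k = 0 ∧ 0 < lam.colLen k := by
    intro k hk hk'
    refine ⟨?_, ?_⟩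
    · by_contra hc
      have := YoungDiagram.mem_iff_lt_rowLen.1
        (YoungDiagram.mem_iff_lt_colLen.2 (Nat.pos_of_ne_zero hc))
      omega
    · exact YoungDiagram.mem_iff_lt_colLen.1 (YoungDiagram.mem_iff_lt_rowLen.2 hk')
  have hlast := h0 (lam.rowLen 0 - 1) (by omega) (by omega)
  -- An empty column `j` separates the diagram: boxes to its left are in rows from `α.colLen j` on,
  -- boxes to its right in rows before `lam.colLen j`, and these numbers agree. Both sides are
  -- non-empty by `hcol` and `hrow`.
  refine hconn.2 ⟨(SkewChar.skewCells lam α).filter (fun c => c.2 < j),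
    (SkewChar.skewCells lam α).filter (fun c => j < c.2), ?_, ?_, ?_, ?_, ?_⟩
  · refine ⟨(α.colLen 0, 0), ?_⟩
    rw [mem_filter, hmem]
    refine ⟨⟨hcol, le_rfl⟩, Nat.pos_of_ne_zero ?_⟩
    rintro rfl
    omega
  · refine ⟨(0, lam.rowLen 0 - 1), ?_⟩
    rw [mem_filter, hmem]
    refine ⟨⟨hlast.2, hlast.1.le⟩, ?_⟩
    by_contra hc
    have : j = lam.rowLen 0 - 1 := by simp only at hc; omega
    rw [this] at heq
    omega
  · ext c
    rw [mem_union, mem_filter, mem_filter, ← and_or_left, and_iff_left_iff_imp, hmem]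
    rintro ⟨h1, h2⟩
    rw [← Nat.ne_iff_lt_or_gt]
    rintro h3
    rw [h3] at h1 h2
    omega
  · rw [disjoint_filter]
    intro c _ h1 h2
    omega
  · intro a ha b hb
    rw [mem_filter, hmem] at ha hb
    refine ⟨fun h => ?_, by omega⟩
    have h1 := lam.colLen_anti j b.2 hb.2.le
    have h2 := α.colLen_anti a.2 j ha.2.le
    omega

theorem exists_rowLen_of_mem_rowLens {μ : YoungDiagram} {x : ℕ} (hx : x ∈ μ.rowLens) :
    ∃ i, μ.rowLen i = x := by
  obtain ⟨i, _, hi⟩ := List.mem_map.1 hx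
  exact ⟨i, hi⟩

theorem exists_two_rowLens {μ : YoungDiagram} (h : 2 ≤ SkewChar.numPartSizes μ) :
    ∃ i j, μ.rowLen j < μ.rowLen i ∧ 0 < μ.rowLen j := by
  obtain ⟨x, hx, y, hy, hxy⟩ := one_lt_card.1 h
  rw [List.mem_toFinset] at hx hy
  have hx0 := μ.pos_of_mem_rowLens x hx
  have hy0 := μ.pos_of_mem_rowLens y hy
  obtain ⟨i, rfl⟩ := exists_rowLen_of_mem_rowLens hx
  obtain ⟨j, rfl⟩ := exists_rowLen_of_mem_rowLens hy
  rcases lt_or_gt_of_ne hxy with h | h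
  · exact ⟨j, i, h, hx0⟩
  · exact ⟨i, j, h, hy0⟩

theorem exists_three_rowLens {μ : YoungDiagram} (h : 3 ≤ SkewChar.numPartSizes μ) :
    ∃ i j k, μ.rowLen j < μ.rowLen i ∧ μ.rowLen k < μ.rowLen j ∧ 0 < μ.rowLen k := by
  obtain ⟨x, hx, y, hy, z, hz, hxy, hxz, hyz⟩ := two_lt_card.1 h
  rw [List.mem_toFinset] at hx hy hz
  have hx0 := μ.pos_of_mem_rowLens x hx
  have hy0 := μ.pos_of_mem_rowLens y hy
  have hz0 := μ.pos_of_mem_rowLens z hz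
  obtain ⟨i, rfl⟩ := exists_rowLen_of_mem_rowLens hx
  obtain ⟨j, rfl⟩ := exists_rowLen_of_mem_rowLens hy
  obtain ⟨k, rfl⟩ := exists_rowLen_of_mem_rowLens hz
  rcases lt_or_gt_of_ne hxy with h1 | h1 <;> rcases lt_or_gt_of_ne hxz with h2 | h2 <;>
    rcases lt_or_gt_of_ne hyz with h3 | h3
  · exact ⟨k, j, i, by omega, by omega, by omega⟩
  · exact ⟨j, k, i, by omega, by omega, by omega⟩
  · omega
  · exact ⟨j, i, k, by omega, by omega, by omega⟩
  · exact ⟨k, i, j, by omega, by omega, by omega⟩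
  · omega
  · exact ⟨i, k, j, by omega, by omega, by omega⟩
  · exact ⟨i, j, k, by omega, by omega, by omega⟩

theorem exists_colLen_between (hrow : α.rowLen 0 < lam.rowLen 0)
    (hj : 2 ≤ SkewChar.numPartSizes α) :
    ∃ q, q < lam.rowLen 0 ∧ 0 < α.colLen q ∧ α.colLen q < α.colLen 0 := by
  obtain ⟨i, j, hij, hj0⟩ := exists_two_rowLens hj
  -- With columns counted from `0`, this is the first column missed by row `j`; the longer row `i`
  -- still meets it.
  refine ⟨α.rowLen j, ?_, ?_, ?_⟩
  · have := α.rowLen_anti 0 i (Nat.zero_le i)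
    omega
  · have := YoungDiagram.mem_iff_lt_colLen.1 (YoungDiagram.mem_iff_lt_rowLen.2 hij)
    omega
  · have h1 := YoungDiagram.mem_iff_lt_colLen.1 (YoungDiagram.mem_iff_lt_rowLen.2 hj0)
    by_contra! hc
    have := YoungDiagram.mem_iff_lt_rowLen.1 (YoungDiagram.mem_iff_lt_colLen.2 (h1.trans_le hc))
    omega

theorem exists_colLen_between_last (hi : 3 ≤ SkewChar.numPartSizes lam) :
    ∃ q, q < lam.rowLen 0 ∧ lam.colLen (lam.rowLen 0 - 1) < lam.colLen q ∧
      lam.colLen q < lam.colLen 0 := by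
  obtain ⟨i, j, k, hij, hjk, hk0⟩ := exists_three_rowLens hi
  have hi0 := lam.rowLen_anti 0 i (Nat.zero_le i)
  -- The first column missed by row `k`. It is met by row `j`, which in turn misses the last column.
  refine ⟨lam.rowLen k, by omega, ?_, ?_⟩
  · have h1 := YoungDiagram.mem_iff_lt_colLen.1 (YoungDiagram.mem_iff_lt_rowLen.2 hjk)
    refine lt_of_le_of_lt ?_ h1
    by_contra! hc
    have := YoungDiagram.mem_iff_lt_rowLen.1 (YoungDiagram.mem_iff_lt_colLen.2 hc)
    omega
  · have h1 := YoungDiagram.mem_iff_lt_colLen.1 (YoungDiagram.mem_iff_lt_rowLen.2 hk0)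
    by_contra! hc
    have := YoungDiagram.mem_iff_lt_rowLen.1 (YoungDiagram.mem_iff_lt_colLen.2 (h1.trans_le hc))
    omega

/-! ### Choice of the columns -/

/-- Two patterns for some of the columns of a skew diagram without empty columns extend to the whole
diagram. -/
theorem hasTwoPatterns_of_subset {N : ℕ} (hα : α.rowLen 0 ≤ N) (hlam : lam.rowLen 0 ≤ N)
    (hsub : α ≤ lam) {s : Finset ℕ} (hs : s ⊆ range N)
    (H : HasTwoPatterns (fun i => ∑ j ∈ s, if i < α.colLen j then 1 else 0)
      (fun i => ∑ j ∈ s, if i < lam.colLen j then 1 else 0)) :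
    HasTwoPatterns α.rowLen lam.rowLen := by
  have h2 := IsPatternOf.sum (range N \ s) (fun j _ => isPatternOf_plain (colLen_mono hsub j))
  convert H.add h2 using 1
  · funext i
    rw [← α.sum_range_colLen hα i, ← sum_sdiff hs, add_comm]
    simp [Finset.sum_apply]
  · funext i
    rw [← lam.sum_range_colLen hlam i, ← sum_sdiff hs, add_comm]
    simp [Finset.sum_apply]

theorem hasTwoPatterns_of_isConnectedDiagram (hsub : α ≤ lam) (hrow : α.rowLen 0 < lam.rowLen 0)
    (hcol : α.colLen 0 < lam.colLen 0)
    (hconn : SkewChar.IsConnectedDiagram (SkewChar.skewCells lam α))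
    (hj : 2 ≤ SkewChar.numPartSizes α) (hi : 3 ≤ SkewChar.numPartSizes lam) :
    HasTwoPatterns α.rowLen lam.rowLen := by
  have hlt : ∀ j, j < lam.rowLen 0 → α.colLen j < lam.colLen j := fun j hj =>
    colLen_lt_colLen hsub hrow hcol hconn hj
  obtain ⟨p, hpN, hp0, hp⟩ := exists_colLen_between hrow hj
  obtain ⟨q, hqN, hq0, hq⟩ := exists_colLen_between_last hi
  obtain ⟨N, hN⟩ : ∃ N, N + 1 = lam.rowLen 0 := ⟨lam.rowLen 0 - 1, by omega⟩
  rw [← hN, Nat.add_sub_cancel] at hq0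
  have htN : α.colLen N = 0 := by
    by_contra hc
    have := YoungDiagram.mem_iff_lt_rowLen.1
      (YoungDiagram.mem_iff_lt_colLen.2 (Nat.pos_of_ne_zero hc))
    omega
  have hα0 := fun j => α.colLen_anti 0 j (Nat.zero_le j)
  have hlam0 := fun j => lam.colLen_anti 0 j (Nat.zero_le j)
  have hlamN := fun j (h : j < lam.rowLen 0) => lam.colLen_anti j N (by omega)
  have h0 := hlt 0 (by omega)
  have hNlt := hlt N (by omega)
  have three : ∀ r, r < lam.rowLen 0 → 0 < α.colLen r → α.colLen r < α.colLen 0 →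
      lam.colLen N < lam.colLen r → lam.colLen r < lam.colLen 0 →
      HasTwoPatterns α.rowLen lam.rowLen := by
    intro r hr h1 h2 h3 h4
    have hr0 : r ≠ 0 := by rintro rfl; omega
    have hrN : r ≠ N := by rintro rfl; omega
    refine hasTwoPatterns_of_subset (N := lam.rowLen 0) hrow.le le_rfl hsub (s := {0, r, N}) ?_ ?_
    · intro j hj
      simp only [mem_insert, mem_singleton, mem_range] at hj ⊢
      omega
    · have hn1 : (0 : ℕ) ∉ ({r, N} : Finset ℕ) := by simp; omega
      have hn2 : r ∉ ({N} : Finset ℕ) := by simpa using hrN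
      simp only [sum_insert hn1, sum_insert hn2, sum_singleton, ← add_assoc]
      exact hasTwoPatterns_three_columns h2 (by omega) h4 h3 h0 (hlt r hr) hNlt
  -- If the bottom of `p` is extreme, consider `q`. Since its bottom is not, `q` is on a known side
  -- of `p`, which bounds its top by that of `p`; so `q` is intermediate in both respects unless its
  -- top is the opposite extreme, the four-column case.
  rcases eq_or_ne (lam.colLen p) (lam.colLen 0) with hpb | hpb
  · by_cases hqt : α.colLen q = 0
    · have hp0' : p ≠ 0 := by rintro rfl; omega
      have hqN' : q ≠ N := by rintro rfl; omega
      have hpq : p ≠ q := by rintro rfl; omega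
      refine hasTwoPatterns_of_subset (N := lam.rowLen 0) hrow.le le_rfl hsub
        (s := {0, p, q, N}) ?_ ?_
      · intro j hj
        simp only [mem_insert, mem_singleton, mem_range] at hj ⊢
        omega
      · have hq0' : q ≠ 0 := by rintro rfl; omega
        have hpN' : p ≠ N := by rintro rfl; omega
        have hn1 : (0 : ℕ) ∉ ({p, q, N} : Finset ℕ) := by simp; omega
        have hn2 : p ∉ ({q, N} : Finset ℕ) := by simp; omega
        have hn3 : q ∉ ({N} : Finset ℕ) := by simpa using hqN'
        simp only [sum_insert hn1, sum_insert hn2, sum_insert hn3, sum_singleton, ← add_assoc]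
        rw [hpb, hqt, htN]
        exact hasTwoPatterns_four_columns_bottom hp hp0 hq hq0 h0 (by omega)
    · have hpq : p ≤ q := by
        by_contra! hc
        have := lam.colLen_anti q p hc.le
        omega
      have := α.colLen_anti p q hpq
      exact three q hqN (Nat.pos_of_ne_zero hqt) (by omega) hq0 hq
  · rcases eq_or_ne (lam.colLen p) (lam.colLen N) with hpb' | hpb'
    · by_cases hqt : α.colLen q = α.colLen 0
      · have hp0' : p ≠ 0 := by rintro rfl; omega
        have hqN' : q ≠ N := by rintro rfl; omega
        have hpq : p ≠ q := by rintro rfl; omega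
        refine hasTwoPatterns_of_subset (N := lam.rowLen 0) hrow.le le_rfl hsub
          (s := {0, q, p, N}) ?_ ?_
        · intro j hj
          simp only [mem_insert, mem_singleton, mem_range] at hj ⊢
          omega
        · have hq0' : q ≠ 0 := by rintro rfl; omega
          have hpN' : p ≠ N := by rintro rfl; omega
          have hn1 : (0 : ℕ) ∉ ({q, p, N} : Finset ℕ) := by simp; omega
          have hn2 : q ∉ ({p, N} : Finset ℕ) := by simp; omega
          have hn3 : p ∉ ({N} : Finset ℕ) := by simpa using hpN'
          have h1 := hlt q hqN
          have h2 := hlt p hpN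
          simp only [sum_insert hn1, sum_insert hn2, sum_insert hn3, sum_singleton, ← add_assoc]
          rw [hqt] at h1 ⊢
          rw [hpb'] at h2 ⊢
          exact hasTwoPatterns_four_columns_top hp (by omega) hq hq0 h1 h2
      · have hpq : q ≤ p := by
          by_contra! hc
          have := lam.colLen_anti p q hc.le
          omega
        have := α.colLen_anti q p hpq
        have := hα0 q
        exact three q hqN (by omega) (by omega) hq0 hq
    · have := hlam0 p
      have := hlamN p hpN
      exact three p hpN hp0 hp (by omega) (by omega)

end

/-! ### From coefficients to characters -/

namespace SkewChar

section

variable {G V W : Type} [Group G] [AddCommGroup V] [Module ℂ V] [FiniteDimensional ℂ V]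
  [AddCommGroup W] [Module ℂ W] [FiniteDimensional ℂ W]

theorem charInner_character [Fintype G] (ρ : Representation ℂ G V) (σ : Representation ℂ G W) :
    charInner σ.character ρ.character = Module.finrank ℂ (Representation.IntertwiningMap ρ σ) := by
  have hne : (Nat.card G : ℂ) ≠ 0 := Nat.cast_ne_zero.2 Nat.card_pos.ne'
  let _ : Invertible (Nat.card G : ℂ) := invertibleOfNonzero hne
  rw [charInner, Fintype.card_eq_nat_card]
  exact Representation.card_inv_mul_sum_char_mul_char_eq_finrank ρ σ

theorem exists_nat_charInner_character [Fintype G] (ρ : Representation ℂ G V)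
    (σ : Representation ℂ G W) : ∃ d : ℕ, charInner σ.character ρ.character = d :=
  ⟨_, charInner_character ρ σ⟩

theorem charInner_sum [Fintype G] {ι : Type} (s : Finset ι) (c : ι → ℂ) (χ : ι → G → ℂ) (ψ : G → ℂ) :
    charInner (fun g => ∑ i ∈ s, c i * χ i g) ψ = ∑ i ∈ s, c i * charInner (χ i) ψ := by
  simp only [charInner, sum_mul, mul_sum]
  rw [sum_comm]
  exact sum_congr rfl fun i _ => sum_congr rfl fun g _ => by ring

/-- A non-zero finite-dimensional representation contains an irreducible one. -/
theorem exists_irreducible_subrepresentation [Nontrivial W] (σ : Representation ℂ G W) :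
    ∃ τ : Subrepresentation σ, τ.toSubmodule ≠ ⊥ ∧ τ.toRepresentation.IsIrreducible := by
  classical
  -- A non-zero subrepresentation of least dimension is irreducible: a non-zero subrepresentation of
  -- it is also one of `σ`, hence has full dimension.
  have hex : ∃ n, ∃ τ : Subrepresentation σ, τ ≠ ⊥ ∧ Module.finrank ℂ τ.toSubmodule = n := by
    refine ⟨_, ⊤, ?_, rfl⟩
    intro h
    exact top_ne_bot (α := Submodule ℂ W) (congrArg Subrepresentation.toSubmodule h)
  obtain ⟨τ, hτ, hn⟩ := Nat.find_spec hex
  have hτ' : τ.toSubmodule ≠ ⊥ := fun h => hτ (Subrepresentation.toSubmodule_injective h)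
  refine ⟨τ, hτ', ?_⟩
  refine { exists_pair_ne := ⟨⊥, ⊤, fun h => ?_⟩, eq_bot_or_eq_top := fun π => ?_ }
  · have h1 : (⊥ : Submodule ℂ τ.toSubmodule) = ⊤ := congrArg Subrepresentation.toSubmodule h
    have : Nontrivial τ.toSubmodule := Submodule.nontrivial_iff_ne_bot.2 hτ'
    exact bot_ne_top h1
  · by_cases hπ : π = ⊥
    · exact Or.inl hπ
    right
    let κ : Subrepresentation σ :=
      { toSubmodule := π.toSubmodule.map τ.toSubmodule.subtype
        apply_mem_toSubmodule := by
          rintro g _ ⟨v, hv, rfl⟩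
          exact ⟨τ.toRepresentation g v, π.apply_mem_toSubmodule g hv, rfl⟩ }
    have hfin : Module.finrank ℂ κ.toSubmodule = Module.finrank ℂ π.toSubmodule :=
      LinearEquiv.finrank_eq
        (Submodule.equivMapOfInjective _ τ.toSubmodule.injective_subtype _).symm
    have hκ : κ ≠ ⊥ := fun h => hπ <| Subrepresentation.toSubmodule_injective <| by
      have h1 : π.toSubmodule.map τ.toSubmodule.subtype = ⊥ :=
        congrArg Subrepresentation.toSubmodule h
      exact Submodule.map_injective_of_injective τ.toSubmodule.injective_subtype
        (h1.trans (Submodule.map_bot _).symm)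
    have hmin := Nat.find_min' hex ⟨κ, hκ, rfl⟩
    refine Subrepresentation.toSubmodule_injective (Submodule.eq_top_of_finrank_eq ?_)
    refine le_antisymm (Submodule.finrank_le _) ?_
    rw [← hfin, hn]
    exact hmin

/-- The inclusion of a subrepresentation as an intertwining map. -/
def subrepresentationInclusion {σ : Representation ℂ G W} (τ : Subrepresentation σ) :
    Representation.IntertwiningMap τ.toRepresentation σ where
  toLinearMap := τ.toSubmodule.subtype
  isIntertwining' _ := rfl

theorem finrank_intertwiningMap_subrepresentation_pos {σ : Representation ℂ G W}
    {τ : Subrepresentation σ} (hτ : τ.toSubmodule ≠ ⊥) :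
    0 < Module.finrank ℂ (Representation.IntertwiningMap τ.toRepresentation σ) := by
  have : Nontrivial (Representation.IntertwiningMap τ.toRepresentation σ) := by
    refine ⟨subrepresentationInclusion τ, 0, fun h => hτ ?_⟩
    rw [Submodule.eq_bot_iff]
    intro v hv
    exact congrArg (fun f => f.toLinearMap ⟨v, hv⟩) h
  exact Module.finrank_pos

/-- A non-zero finite-dimensional representation has an irreducible constituent. -/
theorem exists_irreducible_constituent [Fintype G] [Nontrivial W] (σ : Representation ℂ G W) :
    ∃ (V : Type) (_ : AddCommGroup V) (_ : Module ℂ V) (_ : FiniteDimensional ℂ V)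
      (ρ : Representation ℂ G V), ρ.IsIrreducible ∧ charInner σ.character ρ.character ≠ 0 := by
  obtain ⟨τ, hτ, hirr⟩ := exists_irreducible_subrepresentation σ
  refine ⟨τ.toSubmodule, inferInstance, inferInstance, inferInstance, τ.toRepresentation, hirr, ?_⟩
  rw [charInner_character]
  exact Nat.cast_ne_zero.2 (finrank_intertwiningMap_subrepresentation_pos hτ).ne'

end

instance finiteDimensional_spechtModule (n : ℕ) (ν : YoungDiagram) :
    FiniteDimensional ℂ (spechtModule n ν) :=
  FiniteDimensional.span_of_finite ℂ (Set.finite_range _)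

/-- A column permutation that fixes the tabloid keeps every entry in its row and its column, so only
the identity contributes. Hence the Specht module is non-zero. -/
theorem polytabloid_apply_tabloid {n : ℕ} {ν : YoungDiagram} (t : Fin n ≃ ν.cells) :
    polytabloid t (tabloid t) = 1 := by
  classical
  rw [polytabloid, Finsupp.finsetSum_apply, sum_eq_single_of_mem 1]
  · simp
  · exact mem_filter.2 ⟨mem_univ _, fun k => rfl⟩
  · intro π hπ hne
    have hcol : IsColumnPerm t π := by simpa using hπ
    have : tabloid t ∘ π.symm ≠ tabloid t := fun h => hne <| by
      ext k
      have h1 := congrFun h (π k)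
      simp only [Function.comp_apply, Equiv.symm_apply_apply, tabloid] at h1
      have h2 : t k = t (π k) := Subtype.ext (Prod.ext h1 (hcol k).symm)
      rw [← t.injective h2]
      rfl
    simp [tabloidRep, Finsupp.mapDomain_single, this]

theorem nontrivial_spechtModule (ν : YoungDiagram) : Nontrivial (spechtModule ν.card ν) := by
  rw [Submodule.nontrivial_iff_ne_bot]
  intro h
  let t : Fin ν.card ≃ ν.cells := ν.cells.equivFin.symm
  have h1 : polytabloid t ∈ spechtModule ν.card ν := Submodule.subset_span ⟨t, rfl⟩
  rw [h, Submodule.mem_bot] at h1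
  have := polytabloid_apply_tabloid t
  rw [h1] at this
  simp at this

/-- As the multiplicities are natural numbers, the terms of the skew character cannot cancel. -/
theorem exists_nat_charInner_spechtChar {n : ℕ} (μ : YoungDiagram) {V : Type} [AddCommGroup V]
    [Module ℂ V] [FiniteDimensional ℂ V] (ρ : Representation ℂ (Equiv.Perm (Fin n)) V) :
    ∃ d : ℕ, charInner (spechtChar n μ) ρ.character = d := by
  have h := exists_nat_charInner_character (W := spechtModule n μ) ρ (spechtRep n μ)
  exact h

theorem exists_irreducible_constituent_spechtChar (ν : YoungDiagram) :
    ∃ (V : Type) (_ : AddCommGroup V) (_ : Module ℂ V) (_ : FiniteDimensional ℂ V)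
      (ρ : Representation ℂ (Equiv.Perm (Fin ν.card)) V), ρ.IsIrreducible ∧
        charInner (spechtChar ν.card ν) ρ.character ≠ 0 := by
  have := nontrivial_spechtModule ν
  have h := exists_irreducible_constituent (W := spechtModule ν.card ν) (spechtRep ν.card ν)
  exact h

/-- A Littlewood–Richardson coefficient at least `2` makes the skew character fail to be
multiplicity-free. -/
theorem not_isMultiplicityFree_of_two_le_lrCoeff {lam α ν : YoungDiagram}
    (hν : ν.card = (skewCells lam α).card) (h : 2 ≤ lrCoeff lam α ν) :
    ¬ IsMultiplicityFree (skewCharacter lam α) := by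
  intro hmf
  have hmem : ν ∈ partitionsOf (skewCells lam α).card := by
    rw [partitionsOf, Set.Finite.mem_toFinset]
    exact hν
  have hdef : skewCharacter lam α = fun g => ∑ μ ∈ partitionsOf (skewCells lam α).card,
    (lrCoeff lam α μ : ℂ) * spechtChar (skewCells lam α).card μ g := rfl
  -- The group itself depends on the number of boxes, so the character is made opaque before this
  -- number is replaced by `ν.card`.
  generalize skewCharacter lam α = χ at hmf hdef
  generalize hn : (skewCells lam α).card = n at *
  subst hν
  obtain ⟨V, _, _, _, ρ, hρ, hρν⟩ := exists_irreducible_constituent_spechtChar ν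
  have hmul := hmf V ρ hρ
  choose d hd using fun μ => exists_nat_charInner_spechtChar μ ρ
  have hsum : charInner χ ρ.character =
      ((∑ μ ∈ partitionsOf ν.card, lrCoeff lam α μ * d μ : ℕ) : ℂ) := by
    rw [hdef, charInner_sum]
    push_cast
    exact sum_congr rfl fun μ _ => congrArg _ (hd μ)
  have hdν : 0 < d ν := by
    rw [hd ν] at hρν
    exact Nat.pos_of_ne_zero (Nat.cast_ne_zero.1 hρν)
  have hge : 2 ≤ ∑ μ ∈ partitionsOf ν.card, lrCoeff lam α μ * d μ :=
    calc 2 ≤ lrCoeff lam α ν * d ν := le_trans h (Nat.le_mul_of_pos_right _ hdν)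
      _ ≤ _ := single_le_sum (f := fun μ => lrCoeff lam α μ * d μ)
        (fun _ _ => Nat.zero_le _) hmem
  rw [hsum] at hmul
  rcases hmul with h0 | h1
  · rw [Nat.cast_eq_zero] at h0
    omega
  · rw [Nat.cast_eq_one] at h1
    omega

end SkewChar

theorem lemma3p19 (lam α : YoungDiagram) (hsub : α ≤ lam)
    (hrow : α.rowLen 0 < lam.rowLen 0) (hcol : α.colLen 0 < lam.colLen 0)
    (hconn : SkewChar.IsConnectedDiagram (SkewChar.skewCells lam α))
    (hj : 2 ≤ SkewChar.numPartSizes α) (hi : 3 ≤ SkewChar.numPartSizes lam) :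
    ¬ SkewChar.IsMultiplicityFree (SkewChar.skewCharacter lam α) ∧
      ∃ ν : YoungDiagram, ν.card = (SkewChar.skewCells lam α).card ∧
        2 ≤ SkewChar.lrCoeff lam α ν := by
  obtain ⟨ν, hν, h⟩ := (hasTwoPatterns_of_isConnectedDiagram hsub hrow hcol hconn hj
    hi).exists_two_le_lrCoeff
  exact ⟨SkewChar.not_isMultiplicityFree_of_two_le_lrCoeff hν h, ν, hν, h⟩
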